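/- Let $\varepsilon:\mathbb R^2\to\mathbb R$ (points written $\mathbf r=(x,z)$) be bounded and measurable, with $\varepsilon\ge 1$ and $\varepsilon(x+1,z)=\varepsilon(x,z)$, and let $z_-<z_+$ be such that $\varepsilon(x,z)=1$ whenever $x\in[0,1]$ and $z\notin[z_-,z_+]$. Put $D=[0,1]\times[z_-,z_+]$. Fix $k_x\in\mathbb R$, put $k_{x,m}=k_x+2\pi m$ for $m\in\mathbb Z$, and let $$\mathbb C_{k_x}=\mathbb C\setminus\bigcup_{m\in\mathbb Z}\{k_{x,m}^2-is:\ s\ge 0\}.$$ Square roots are $\sqrt w=e^{\frac12\log w}$ with $\log w=\ln|w|+i\arg w$, $-\frac{\pi}{2}<\arg w<\frac{3\pi}{2}$. For $\varsigma\in\mathbb C_{k_x}$ let $$H(\varsigma;x,z)=\frac{i\varsigma}{2}\sum_{m\in\mathbb Z}\frac{e^{i\left(xk_{x,m}+|z|\sqrt{\varsigma-k_{x,m}^2}\right)}}{\sqrt{\varsigma-k_{x,m}^2}}\quad(z\neq 0),$$ and let $\hat H(\varsigma)$ be the Hilbert–Schmidt operator on $L^2(D)$ given by $$\hat H(\varsigma)[E](\mathbf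 r)=\int_D(\varepsilon(\mathbf r_0)-1)\,H(\varsigma;\mathbf r-\mathbf r_0)\,E(\mathbf r_0)\,d\mathbf r_0 .$$ The generalized resolvent is the operator-valued function $\varsigma\mapsto[1-\hat H(\varsigma)]^{-1}$. (a) Let $\varsigma_n=k_n^2-i\Gamma_n\in\mathbb C_{k_x}$, with $k_n^2=\operatorname{Re}\varsigma_n$ and $\Gamma_n=-\operatorname{Im}\varsigma_n$, be a pole of the generalized resolvent. Then $\Gamma_n\ge 0$, so that all poles lie in the closed lower half of the cut plane. Moreover there is a nonzero $E_n\in L^2(D)$ with $\hat H(\varsigma_n)[E_n]=E_n$ (a Siegert state). (b) Let $\varsigma_n\in\mathbb C_{k_x}$, $\Gamma_n=-\operatorname{Im}\varsigma_n$, and let $E_n\in L^2(D)$ be nonzero with $\hat H(\varsigma_n)[E_n]=E_n$. Extend $E_n$ to the whole plane by $E_n(\mathbf r)=\int_D(\varepsilon(\mathbf r_0)-1)H(\varsigma_n;\mathbf r-\mathbf r_0)E_n(\mathbf r_0)\,d\mathbf r_0$; this agrees with $E_n$ almost everywhere on $D$. Put $q_m=\sqrt{\varsigma_n-k_{x,m}^2}$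 and $$S_m^\pm=\frac{i\varsigma_n}{2q_m}\int_D(\varepsilon(\mathbf r_0)-1)E_n(\mathbf r_0)\,e^{i(-x_0k_{x,m}\mp z_0q_m)}\,d\mathbf r_0 .$$ Then $E_n(x,z)=\sum_{m}S_m^-e^{i(xk_{x,m}-zq_m)}$ for $z<z_-$ and $E_n(x,z)=\sum_{m}S_m^+e^{i(xk_{x,m}+zq_m)}$ for $z>z_+$. For all $z_1\le z_-$ and $z_2\ge z_+$, with $D'=[0,1]\times[z_1,z_2]$, the integral $\int_{D'}|E_n|^2\varepsilon$ is finite and positive, the series below converges, and $$\Gamma_n=\frac{\sum_{m\in\mathbb Z}\operatorname{Re}\{q_m\}\left(|S_m^+|^2e^{-2z_2\operatorname{Im}q_m}+|S_m^-|^2e^{2z_1\operatorname{Im}q_m}\right)}{\int_{D'}|E_n(\mathbf r_0)|^2\varepsilon(\mathbf r_0)\,d\mathbf r_0}.$$ Finally, with the finite set of open diffraction channels $I^{op}=\{m\in\mathbb Z:\operatorname{Re}\varsigma_n\ge k_{x,m}^2\}$, $$\Gamma_n=\lim_{\substack{z_1\to-\infty\\ z_2\to+\infty}}\frac{\sum_{m\in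 I^{op}}\operatorname{Re}\{q_m\}\left(|S_m^+|^2e^{-2z_2\operatorname{Im}q_m}+|S_m^-|^2e^{2z_1\operatorname{Im}q_m}\right)}{\int_{D'}|E_n(\mathbf r_0)|^2\varepsilon(\mathbf r_0)\,d\mathbf r_0}.$$ -/

import Mathlib

open MeasureTheory
open scoped ENNReal

namespace PeriodicScattering

theorem memLp_kernel_apply {X : Type*} [MeasurableSpace X] {μ : Measure X} [SFinite μ]
    {K : X × X → ℂ} (hK : MemLp K 2 (μ.prod μ)) (f : Lp ℂ 2 μ) :
    (∀ᵐ r ∂μ, Integrable (fun r₀ => K (r, r₀) * f r₀) μ) ∧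
      MemLp (fun r => ∫ r₀, K (r, r₀) * f r₀ ∂μ) 2 μ ∧
      eLpNorm (fun r => ∫ r₀, K (r, r₀) * f r₀ ∂μ) 2 μ
        ≤ eLpNorm K 2 (μ.prod μ) * eLpNorm f 2 μ := by
  have hfm : AEStronglyMeasurable (fun p : X × X => f p.2) (μ.prod μ) :=
    (Lp.aestronglyMeasurable f).comp_snd
  have hm : AEStronglyMeasurable (fun r => ∫ r₀, K (r, r₀) * f r₀ ∂μ) μ :=
    (hK.1.mul hfm).integral_prod_right'
  have hsq : ∀ {Y : Type _} [MeasurableSpace Y] (ν : Measure Y) (g : Y → ℂ),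
      eLpNorm g 2 ν ^ 2 = ∫⁻ y, ‖g y‖ₑ ^ 2 ∂ν := by
    intro Y _ ν g
    rw [eLpNorm_eq_lintegral_rpow_enorm_toReal (by norm_num) (by norm_num), ← ENNReal.rpow_natCast,
      ← ENNReal.rpow_mul]
    simp
  have hprod : ∫⁻ r, ∫⁻ r₀, ‖K (r, r₀)‖ₑ ^ 2 ∂μ ∂μ = eLpNorm K 2 (μ.prod μ) ^ 2 := by
    rw [hsq, lintegral_prod _ (hK.1.enorm.pow_const 2)]
  have hsec : ∀ᵐ r ∂μ, MemLp (fun r₀ => K (r, r₀)) 2 μ := by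
    have h1 : ∀ᵐ r ∂μ, ∫⁻ r₀, ‖K (r, r₀)‖ₑ ^ 2 ∂μ < ∞ := by
      refine ae_lt_top' ((hK.1.enorm.pow_const 2).lintegral_prod_right') ?_
      rw [hprod]
      exact ENNReal.pow_ne_top hK.2.ne
    filter_upwards [h1, hK.1.prodMk_left] with r h2 h3
    refine ⟨h3, ?_⟩
    rw [← hsq] at h2
    exact (ENNReal.pow_lt_top_iff.1 h2).resolve_right (by norm_num)
  have hle : eLpNorm (fun r => ∫ r₀, K (r, r₀) * f r₀ ∂μ) 2 μ
        ≤ eLpNorm K 2 (μ.prod μ) * eLpNorm f 2 μ := by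
    have h2 : ∀ᵐ r ∂μ, ‖∫ r₀, K (r, r₀) * f r₀ ∂μ‖ₑ ^ 2
        ≤ (∫⁻ r₀, ‖K (r, r₀)‖ₑ ^ 2 ∂μ) * eLpNorm f 2 μ ^ 2 := by
      filter_upwards [hsec] with r hr
      rw [← hsq, ← mul_pow]
      refine pow_le_pow_left' ?_ 2
      refine (enorm_integral_le_lintegral_enorm _).trans ?_
      rw [← eLpNorm_one_eq_lintegral_enorm]
      have h3 := eLpNorm_smul_le_mul_eLpNorm (p := 2) (q := 2) (r := 1)
        (φ := fun r₀ => K (r, r₀)) (Lp.aestronglyMeasurable f) hr.1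
      have h4 : ((fun r₀ => K (r, r₀)) • ⇑f : X → ℂ) = fun r₀ => K (r, r₀) * f r₀ := by
        funext r₀
        simp
      rw [h4] at h3
      exact h3
    rw [← ENNReal.pow_le_pow_left_iff (n := 2) (by norm_num), mul_pow, hsq μ, ← hprod,
      ← lintegral_mul_const'' _ ((hK.1.enorm.pow_const 2).lintegral_prod_right')]
    exact lintegral_mono_ae h2
  refine ⟨?_, ⟨hm, ?_⟩, hle⟩
  · filter_upwards [hsec] with r hr
    exact hr.integrable_mul (Lp.memLp f)
  · exact hle.trans_lt (ENNReal.mul_lt_top hK.2 (Lp.eLpNorm_lt_top f))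

open Classical in
/-- The Hilbert-Schmidt integral operator `f ↦ ∫ K (·, r₀) f r₀ ∂μ r₀` on `L²(μ)` of a kernel
`K ∈ L²(μ × μ)` (and `0` by convention if the kernel is not square integrable). -/
noncomputable def kernelOperator {X : Type*} [MeasurableSpace X] (μ : Measure X) [SFinite μ]
    (K : X × X → ℂ) : Lp ℂ 2 μ →L[ℂ] Lp ℂ 2 μ :=
  if hK : MemLp K 2 (μ.prod μ) then
    LinearMap.mkContinuous
      { toFun := fun f => (memLp_kernel_apply hK f).2.1.toLp
        map_add' := by
          intro f g
          rw [← MemLp.toLp_add, MemLp.toLp_eq_toLp_iff]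
          filter_upwards [(memLp_kernel_apply hK f).1, (memLp_kernel_apply hK g).1] with r h1 h2
          rw [Pi.add_apply, ← integral_add h1 h2]
          refine integral_congr_ae ?_
          filter_upwards [Lp.coeFn_add f g] with r₀ h3
          rw [h3, Pi.add_apply, mul_add]
        map_smul' := by
          intro c f
          rw [RingHom.id_apply, ← MemLp.toLp_const_smul, MemLp.toLp_eq_toLp_iff]
          refine Filter.Eventually.of_forall fun r => ?_
          rw [Pi.smul_apply, ← integral_smul]
          refine integral_congr_ae ?_
          filter_upwards [Lp.coeFn_smul c f] with r₀ h3
          rw [h3, Pi.smul_apply]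
          simp only [smul_eq_mul]
          ring }
      (eLpNorm K 2 (μ.prod μ)).toReal
      (by
        intro f
        simp only [LinearMap.coe_mk, AddHom.coe_mk, Lp.norm_toLp]
        rw [Lp.norm_def, ← ENNReal.toReal_mul]
        exact ENNReal.toReal_mono (ENNReal.mul_lt_top hK.2 (Lp.eLpNorm_lt_top f)).ne
          (memLp_kernel_apply hK f).2.2)
  else 0

theorem kernelOperator_apply {X : Type*} [MeasurableSpace X] {μ : Measure X} [SFinite μ]
    {K : X × X → ℂ} (hK : MemLp K 2 (μ.prod μ)) (f : Lp ℂ 2 μ) :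
    kernelOperator μ K f =ᵐ[μ] fun r => ∫ r₀, K (r, r₀) * f r₀ ∂μ := by
  rw [kernelOperator, dif_pos hK]
  exact (memLp_kernel_apply hK f).2.1.coeFn_toLp

/-- `k_{x,m} = k_x + 2πm`. -/
noncomputable def xWaveNumber (kx : ℝ) (m : ℤ) : ℝ := kx + 2 * Real.pi * m

/-- The complex plane without the vertical half lines `{k_{x,m}² - i s : s ≥ 0}` that run from the
diffraction thresholds `k_{x,m}²` into the lower half plane. -/
def cutPlane (kx : ℝ) : Set ℂ :=
  {ς | ∀ m : ℤ, ∀ s : ℝ, 0 ≤ s → ς ≠ ((xWaveNumber kx m ^ 2 : ℝ) : ℂ) - Complex.I * s}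

/-- The logarithm `ln |w| + i arg w` with `-π/2 < arg w < 3π/2`, that is, with its branch cut along
the negative imaginary axis: `arg w` is `π/2` plus the principal argument of `-i w`. -/
noncomputable def cutLog (w : ℂ) : ℂ :=
  Complex.log (-Complex.I * w) + (Real.pi / 2 : ℝ) * Complex.I

/-- The square root `exp (log w / 2)` for the logarithm `cutLog`. -/
noncomputable def cutSqrt (w : ℂ) : ℂ := if w = 0 then 0 else Complex.exp (cutLog w / 2)

/-- `√(ς - k_{x,m}²)`. -/
noncomputable def zWaveNumber (kx : ℝ) (ς : ℂ) (m : ℤ) : ℂ :=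
  cutSqrt (ς - ((xWaveNumber kx m ^ 2 : ℝ) : ℂ))

/-- `H(ς; x, z) = (iς/2) ∑ₘ exp (i (x k_{x,m} + |z| √(ς - k_{x,m}²))) / √(ς - k_{x,m}²)`,
a point of the plane being written as `r = (x, z)`. For `ς` in the cut plane the series converges
absolutely whenever `z ≠ 0`. -/
noncomputable def greenKernel (kx : ℝ) (ς : ℂ) (r : ℝ × ℝ) : ℂ :=
  Complex.I * ς / 2 * ∑' m : ℤ,
    Complex.exp (Complex.I * (r.1 * xWaveNumber kx m + |r.2| * zWaveNumber kx ς m))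
      / zWaveNumber kx ς m

/-- The rectangle `[0,1] × [z₁,z₂]`. -/
def cell (z₁ z₂ : ℝ) : Set (ℝ × ℝ) := Set.Icc 0 1 ×ˢ Set.Icc z₁ z₂

/-- The kernel `(r, r₀) ↦ (ε(r₀) - 1) H(ς; r - r₀)`. -/
noncomputable def scatteringKernel (ε : ℝ × ℝ → ℝ) (kx : ℝ) (ς : ℂ)
    (p : (ℝ × ℝ) × (ℝ × ℝ)) : ℂ :=
  ((ε p.2 : ℂ) - 1) * greenKernel kx ς (p.1 - p.2)

theorem cutSqrt_sq (w : ℂ) : cutSqrt w ^ 2 = w := by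
  unfold cutSqrt cutLog
  split_ifs with h
  · simp [h]
  · rw [← Complex.exp_nat_mul]
    push_cast
    rw [mul_div_cancel₀ _ (two_ne_zero), Complex.exp_add, Complex.exp_log (by simp [h]),
      Complex.exp_pi_div_two_mul_I]
    linear_combination (-w) * Complex.I_mul_I

theorem cutSqrt_im_pos {w : ℂ} (hw : w.re < 0) : 0 < (cutSqrt w).im := by
  have h0 : w ≠ 0 := by
    rintro rfl
    simp at hw
  have hre : (-Complex.I * w).im = -w.re := by simp
  have h1 : 0 < (-Complex.I * w).arg := by
    have := Complex.arg_nonneg_iff.2 (show 0 ≤ (-Complex.I * w).im by rw [hre]; linarith)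
    rcases this.lt_or_eq with h | h
    · exact h
    · have := (Complex.arg_eq_zero_iff.1 h.symm).2
      rw [hre] at this
      linarith
  have h2 := Complex.arg_le_pi (-Complex.I * w)
  rw [cutSqrt, if_neg h0, Complex.exp_im]
  refine mul_pos (Real.exp_pos _) ?_
  have h3 : (cutLog w / 2).im = ((-Complex.I * w).arg + Real.pi / 2) / 2 := by
    have h4 : cutLog w / 2 = ((1 / 2 : ℝ) : ℂ) * cutLog w := by
      push_cast
      ring
    have h5 : (cutLog w).im = (-Complex.I * w).arg + Real.pi / 2 := by
      rw [cutLog, Complex.add_im, Complex.log_im, Complex.im_ofReal_mul, Complex.I_im, mul_one]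
    rw [h4, Complex.im_ofReal_mul, h5]
    ring
  rw [h3]
  exact Real.sin_pos_of_pos_of_lt_pi (by linarith [Real.pi_pos]) (by linarith [Real.pi_pos])

theorem zWaveNumber_ne_zero {kx : ℝ} {ς : ℂ} (hς : ς ∈ cutPlane kx) (m : ℤ) :
    zWaveNumber kx ς m ≠ 0 := by
  intro h
  have h1 := cutSqrt_sq (ς - ((xWaveNumber kx m ^ 2 : ℝ) : ℂ))
  rw [zWaveNumber] at h
  rw [h] at h1
  refine hς m 0 le_rfl ?_
  simp only [Complex.ofReal_zero, mul_zero, sub_zero]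
  linear_combination -h1

theorem norm_channel_term (kx : ℝ) (ς : ℂ) (r : ℝ × ℝ) (m : ℤ) :
    ‖Complex.exp (Complex.I * (r.1 * xWaveNumber kx m + |r.2| * zWaveNumber kx ς m))
      / zWaveNumber kx ς m‖ =
      Real.exp (-(|r.2| * (zWaveNumber kx ς m).im)) / ‖zWaveNumber kx ς m‖ := by
  rw [norm_div, Complex.norm_exp]
  congr 2
  simp

theorem finite_channels (kx R : ℝ) :
    {m : ℤ | xWaveNumber kx m ^ 2 ≤ (m : ℝ) ^ 2 + R}.Finite := by
  refine (Set.finite_Icc (-⌈|kx| + |R| + 1⌉) ⌈|kx| + |R| + 1⌉).subset ?_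
  intro m hm
  by_contra hcon
  have hB : |kx| + |R| + 1 < |(m : ℝ)| := by
    by_contra! hle
    refine hcon ?_
    have h := abs_le.1 (hle.trans (Int.le_ceil _))
    exact ⟨by exact_mod_cast h.1, by exact_mod_cast h.2⟩
  have h3 : 2 * |(m : ℝ)| ≤ |xWaveNumber kx m| := by
    have h4 : |2 * Real.pi * (m : ℝ)| = 2 * Real.pi * |(m : ℝ)| := by
      rw [abs_mul, abs_of_pos Real.two_pi_pos]
    have h5 : |2 * Real.pi * (m : ℝ)| ≤ |xWaveNumber kx m| + |kx| := by
      have h6 := abs_sub (xWaveNumber kx m) kx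
      rwa [show xWaveNumber kx m - kx = 2 * Real.pi * m by rw [xWaveNumber]; ring] at h6
    nlinarith [Real.pi_gt_three, abs_nonneg (m : ℝ), abs_nonneg R, abs_nonneg kx]
  have h7 : 4 * (m : ℝ) ^ 2 ≤ xWaveNumber kx m ^ 2 := by
    rw [← sq_abs (xWaveNumber kx m), ← sq_abs (m : ℝ)]
    nlinarith [abs_nonneg (m : ℝ)]
  have h8 : xWaveNumber kx m ^ 2 ≤ (m : ℝ) ^ 2 + R := hm
  have h9 : |R| < (m : ℝ) ^ 2 := by
    rw [← sq_abs (m : ℝ)]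
    nlinarith [abs_nonneg R, abs_nonneg kx]
  linarith [le_abs_self R, sq_nonneg (m : ℝ)]

theorem exp_neg_le_rpow {t : ℝ} (ht : 0 < t) : Real.exp (-t) ≤ t ^ (-(1 / 4) : ℝ) := by
  rw [Real.rpow_neg ht.le, Real.exp_neg]
  refine inv_anti₀ (by positivity) ?_
  rcases le_total t 1 with h | h
  · exact (Real.rpow_le_one ht.le h (by norm_num)).trans (Real.one_le_exp ht.le)
  · calc t ^ (1 / 4 : ℝ) ≤ t ^ (1 : ℝ) := Real.rpow_le_rpow_of_exponent_le h (by norm_num)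
      _ = t := Real.rpow_one t
      _ ≤ Real.exp t := by linarith [Real.add_one_le_exp t]

theorem exists_channel_bound {kx : ℝ} {ς : ℂ} (hς : ς ∈ cutPlane kx) (L : ℝ) :
    ∃ A : ℤ → ℝ, Summable A ∧ ∀ m : ℤ, ∀ z : ℝ, 0 < |z| → |z| ≤ L →
      Real.exp (-(|z| * (zWaveNumber kx ς m).im)) / ‖zWaveNumber kx ς m‖
        ≤ A m * |z| ^ (-(1 / 4) : ℝ) := by
  classical
  set q := zWaveNumber kx ς with hq
  have hq0 : ∀ m, 0 < ‖q m‖ := fun m => norm_pos_iff.2 (zWaveNumber_ne_zero hς m)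
  have hev : ∀ᶠ m : ℤ in Filter.cofinite, |(m : ℝ)| / 2 ≤ (q m).im ∧ |(m : ℝ)| ≤ ‖q m‖ ∧ m ≠ 0 := by
    have h1 := (finite_channels kx ς.re).compl_mem_cofinite
    have h2 : ∀ᶠ m : ℤ in Filter.cofinite, m ≠ 0 := (Set.finite_singleton (0 : ℤ)).compl_mem_cofinite
    filter_upwards [h1, h2] with m hm hm0
    have h3 : (m : ℝ) ^ 2 + ς.re < xWaveNumber kx m ^ 2 := by
      simpa using hm
    have h4 : (q m) ^ 2 = ς - ((xWaveNumber kx m ^ 2 : ℝ) : ℂ) := cutSqrt_sq _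
    have h5 : (q m).re * (q m).re - (q m).im * (q m).im = ς.re - xWaveNumber kx m ^ 2 := by
      have h := congrArg Complex.re h4
      rw [sq, Complex.mul_re, Complex.sub_re, Complex.ofReal_re] at h
      exact h
    have h6 : 0 < (q m).im := by
      refine cutSqrt_im_pos ?_
      rw [Complex.sub_re, Complex.ofReal_re]
      nlinarith [sq_nonneg (m : ℝ)]
    have h7 : |(m : ℝ)| ≤ (q m).im := by
      refine abs_le_of_sq_le_sq ?_ h6.le
      nlinarith [mul_self_nonneg (q m).re]
    exact ⟨by linarith [abs_nonneg (m : ℝ)], h7.trans ((le_abs_self _).trans (Complex.abs_im_le_norm _)), hm0⟩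
  let G : ℤ → Prop := fun m => |(m : ℝ)| / 2 ≤ (q m).im ∧ |(m : ℝ)| ≤ ‖q m‖ ∧ m ≠ 0
  refine ⟨fun m => if G m then (|(m : ℝ)| / 2) ^ (-(1 / 4) : ℝ) * |(m : ℝ)| ^ (-1 : ℝ)
    else L ^ (1 / 4 : ℝ) * (Real.exp (L * ‖q m‖) / ‖q m‖), ?_, ?_⟩
  · have hs : Summable fun m : ℤ => (1 / 2 : ℝ) ^ (-(1 / 4) : ℝ) * |(m : ℝ)| ^ (-(5 / 4) : ℝ) :=
      (Real.summable_abs_int_rpow (by norm_num)).mul_left _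
    refine summable_of_isBigO hs (Filter.EventuallyEq.isBigO ?_)
    filter_upwards [hev] with m hm
    have hm' : 0 < |(m : ℝ)| := abs_pos.2 (by exact_mod_cast hm.2.2)
    rw [if_pos hm, div_eq_mul_one_div, Real.mul_rpow hm'.le (by norm_num),
      show (-(5 / 4) : ℝ) = -(1 / 4) + -1 by norm_num, Real.rpow_add hm']
    ring
  · intro m z hz hzL
    beta_reduce
    split_ifs with hm
    · have hm' : 0 < |(m : ℝ)| := abs_pos.2 (by exact_mod_cast hm.2.2)
      have h1 : Real.exp (-(|z| * (q m).im)) ≤ (|z| * (|(m : ℝ)| / 2)) ^ (-(1 / 4) : ℝ) := by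
        refine le_trans (Real.exp_le_exp.2 ?_) (exp_neg_le_rpow (by positivity))
        exact neg_le_neg (mul_le_mul_of_nonneg_left hm.1 hz.le)
      rw [Real.mul_rpow hz.le (by positivity)] at h1
      rw [Real.rpow_neg_one, div_eq_mul_inv]
      calc _ ≤ (|z| ^ (-(1 / 4) : ℝ) * (|(m : ℝ)| / 2) ^ (-(1 / 4) : ℝ)) * |(m : ℝ)|⁻¹ := by
            gcongr
            exact hm.2.1
        _ = _ := by ring
    · have h1 : Real.exp (-(|z| * (q m).im)) ≤ Real.exp (L * ‖q m‖) := by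
        refine Real.exp_le_exp.2 ?_
        have h2 := neg_abs_le (q m).im
        have h3 := Complex.abs_im_le_norm (q m)
        nlinarith [abs_nonneg z, norm_nonneg (q m)]
      have h2 : 1 ≤ L ^ (1 / 4 : ℝ) * |z| ^ (-(1 / 4) : ℝ) := by
        rw [Real.rpow_neg hz.le, ← div_eq_mul_inv, one_le_div (by positivity)]
        exact Real.rpow_le_rpow hz.le hzL (by norm_num)
      calc _ ≤ 1 * (Real.exp (L * ‖q m‖) / ‖q m‖) := by
            rw [one_mul]
            have := hq0 m
            gcongr
        _ ≤ (L ^ (1 / 4 : ℝ) * |z| ^ (-(1 / 4) : ℝ)) * (Real.exp (L * ‖q m‖) / ‖q m‖) := by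
            have := hq0 m
            gcongr
        _ = _ := by ring

theorem measurable_greenKernel (kx : ℝ) (ς : ℂ) : Measurable (greenKernel kx ς) := by
  unfold greenKernel
  refine Measurable.const_mul (Measurable.tsum fun m => ?_) _
  refine Measurable.div_const ?_ _
  refine Continuous.measurable ?_
  fun_prop

theorem exists_greenKernel_bound {kx : ℝ} {ς : ℂ} (hς : ς ∈ cutPlane kx) (L : ℝ) :
    ∃ C : ℝ, 0 ≤ C ∧ ∀ r : ℝ × ℝ, 0 < |r.2| → |r.2| ≤ L →
      ‖greenKernel kx ς r‖ ≤ C * |r.2| ^ (-(1 / 4) : ℝ) := by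
  obtain ⟨A, hA, hb⟩ := exists_channel_bound hς L
  refine ⟨|‖Complex.I * ς / 2‖ * ∑' m, A m|, abs_nonneg _, fun r h1 h2 => ?_⟩
  rw [greenKernel, norm_mul]
  have h3 := tsum_of_norm_bounded (hA.mul_right (|r.2| ^ (-(1 / 4) : ℝ))).hasSum
    (fun m => (norm_channel_term kx ς r m).trans_le (hb m r.2 h1 h2))
  rw [tsum_mul_right] at h3
  calc _ ≤ ‖Complex.I * ς / 2‖ * ((∑' m, A m) * |r.2| ^ (-(1 / 4) : ℝ)) := by gcongr
    _ = (‖Complex.I * ς / 2‖ * ∑' m, A m) * |r.2| ^ (-(1 / 4) : ℝ) := by ring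
    _ ≤ _ := by
      gcongr
      exact le_abs_self _

theorem intervalIntegrable_abs_rpow (L : ℝ) (hL : 0 ≤ L) :
    IntervalIntegrable (fun t : ℝ => |t| ^ (-(1 / 2) : ℝ)) volume (-L) L := by
  have h1 : IntervalIntegrable (fun t : ℝ => |t| ^ (-(1 / 2) : ℝ)) volume 0 L := by
    refine (intervalIntegral.intervalIntegrable_rpow' (r := -(1 / 2)) (by norm_num)).congr ?_
    intro t ht
    rw [Set.uIoc_of_le hL] at ht
    simp only [abs_of_pos ht.1]
  have h2 := (IntervalIntegrable.iff_comp_neg).1 h1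
  simp only [abs_neg, neg_zero] at h2
  exact h2.symm.trans h1

/-- For `ς` in the cut plane the kernel is square integrable over `D × D`. -/
theorem memLp_scatteringKernel {ε : ℝ × ℝ → ℝ} (hε : Measurable ε) {M : ℝ} (h1 : ∀ r, 1 ≤ ε r)
    (hM : ∀ r, ε r ≤ M) {kx : ℝ} {ς : ℂ} (hς : ς ∈ cutPlane kx) (z₁ z₂ : ℝ) :
    MemLp (scatteringKernel ε kx ς) 2
      ((volume.restrict (cell z₁ z₂)).prod (volume.restrict (cell z₁ z₂))) := by
  have hmeas : Measurable (scatteringKernel ε kx ς) := by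
    unfold scatteringKernel
    have := measurable_greenKernel kx ς
    fun_prop
  refine ⟨hmeas.aestronglyMeasurable, ?_⟩
  set L := |z₂ - z₁| with hL
  obtain ⟨C, hC, hb⟩ := exists_greenKernel_bound hς L
  set B : ℝ := (M - 1) * C
  let h : ℝ × ℝ → ℝ≥0∞ := fun r => (Set.Icc (-1 : ℝ) 1).indicator 1 r.1 *
    (Set.Icc (-L) L).indicator (fun t => ENNReal.ofReal (|t| ^ (-(1 / 2) : ℝ))) r.2
  have hh : ∫⁻ r, h r < ∞ := by
    have e : ∫⁻ r, h r = (∫⁻ x, (Set.Icc (-1 : ℝ) 1).indicator (1 : ℝ → ℝ≥0∞) x) *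
        ∫⁻ t, (Set.Icc (-L) L).indicator (fun t => ENNReal.ofReal (|t| ^ (-(1 / 2) : ℝ))) t := by
      refine lintegral_prod_mul ?_ ?_
      · exact (measurable_one.indicator measurableSet_Icc).aemeasurable
      · refine (Measurable.indicator ?_ measurableSet_Icc).aemeasurable
        fun_prop
    rw [e, lintegral_indicator measurableSet_Icc, lintegral_indicator measurableSet_Icc]
    refine ENNReal.mul_lt_top ?_ ?_
    · simp
    · have hi := (intervalIntegrable_iff_integrableOn_Icc_of_le
        (by linarith [abs_nonneg (z₂ - z₁)])).1 (intervalIntegrable_abs_rpow L (abs_nonneg _))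
      have := hi.lintegral_lt_top
      exact this
  rw [eLpNorm_lt_top_iff_lintegral_rpow_enorm_lt_top (by norm_num) (by norm_num)]
  rw [lintegral_prod _ (by fun_prop)]
  have hpt : ∀ r ∈ cell z₁ z₂, ∀ᵐ r₀ ∂(volume.restrict (cell z₁ z₂)),
      ‖scatteringKernel ε kx ς (r, r₀)‖ₑ ^ (2 : ℝ≥0∞).toReal ≤ ENNReal.ofReal (B ^ 2) * h (r - r₀) := by
    intro r hr
    have hne : ∀ᵐ r₀ : ℝ × ℝ, r₀.2 ≠ r.2 := by
      have e : {r₀ : ℝ × ℝ | ¬ r₀.2 ≠ r.2} = Set.univ ×ˢ {r.2} := by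
        ext x
        simp
      rw [ae_iff, e, Measure.volume_eq_prod, Measure.prod_prod]
      simp
    have hcell : MeasurableSet (cell z₁ z₂) := measurableSet_Icc.prod measurableSet_Icc
    filter_upwards [ae_restrict_of_ae hne, ae_restrict_mem hcell] with r₀ hr0 hr1
    obtain ⟨⟨a1, a2⟩, a3, a4⟩ := hr
    obtain ⟨⟨b1, b2⟩, b3, b4⟩ := hr1
    have hz : 0 < |(r - r₀).2| := abs_pos.2 (sub_ne_zero.2 (Ne.symm hr0))
    have hzL : |(r - r₀).2| ≤ L := by
      rw [hL, abs_of_nonneg (by linarith : 0 ≤ z₂ - z₁)]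
      exact abs_le.2 ⟨by simp only [Prod.snd_sub]; linarith, by simp only [Prod.snd_sub]; linarith⟩
    have hx : (r - r₀).1 ∈ Set.Icc (-1 : ℝ) 1 :=
      ⟨by simp only [Prod.fst_sub]; linarith, by simp only [Prod.fst_sub]; linarith⟩
    have hbd : ‖scatteringKernel ε kx ς (r, r₀)‖ ≤ B * |(r - r₀).2| ^ (-(1 / 4) : ℝ) := by
      rw [scatteringKernel, norm_mul]
      have e1 : ‖((ε r₀ : ℂ) - 1)‖ ≤ M - 1 := by
        rw [← Complex.ofReal_one, ← Complex.ofReal_sub, Complex.norm_real, Real.norm_eq_abs,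
          abs_of_nonneg (by linarith [h1 r₀])]
        linarith [hM r₀]
      calc _ ≤ (M - 1) * (C * |(r - r₀).2| ^ (-(1 / 4) : ℝ)) :=
            mul_le_mul e1 (hb _ hz hzL) (norm_nonneg _) ((norm_nonneg _).trans e1)
        _ = _ := by ring
    have e2 : h (r - r₀) = ENNReal.ofReal (|(r - r₀).2| ^ (-(1 / 2) : ℝ)) := by
      simp only [h]
      rw [Set.indicator_of_mem hx, Set.indicator_of_mem (s := Set.Icc (-L) L) (Set.mem_Icc.2 (abs_le.1 hzL))]
      simp
    rw [e2, ← ENNReal.ofReal_mul (sq_nonneg _), ← ofReal_norm,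
      ENNReal.ofReal_rpow_of_nonneg (norm_nonneg _) (by simp)]
    refine ENNReal.ofReal_le_ofReal ?_
    have e3 : |(r - r₀).2| ^ (-(1 / 2) : ℝ) = (|(r - r₀).2| ^ (-(1 / 4) : ℝ)) ^ 2 := by
      rw [← Real.rpow_natCast, ← Real.rpow_mul hz.le]
      norm_num
    rw [e3, ← mul_pow]
    simp only [ENNReal.toReal_ofNat, Real.rpow_two]
    exact pow_le_pow_left₀ (norm_nonneg _) hbd 2
  have hcell : MeasurableSet (cell z₁ z₂) := measurableSet_Icc.prod measurableSet_Icc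
  calc _ ≤ ∫⁻ r in cell z₁ z₂, ENNReal.ofReal (B ^ 2) * ∫⁻ r₀, h r₀ := by
        refine setLIntegral_mono' hcell fun r hr => ?_
        refine (lintegral_mono_ae (hpt r hr)).trans ?_
        refine (setLIntegral_le_lintegral _ _).trans ?_
        rw [lintegral_const_mul' _ _ ENNReal.ofReal_ne_top, lintegral_sub_left_eq_self]
    _ < ∞ := by
        rw [lintegral_const]
        refine ENNReal.mul_lt_top (ENNReal.mul_lt_top ENNReal.ofReal_lt_top hh) ?_
        rw [Measure.restrict_apply_univ, cell, Measure.volume_eq_prod, Measure.prod_prod]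
        simp

/-- The operator `Ĥ(ς) E (r) = ∫_D (ε(r₀) - 1) H(ς; r - r₀) E(r₀) dr₀` on `L²(D)`, where
`D = [0,1] × [zm,zp]`. -/
noncomputable def scatteringOperator (ε : ℝ × ℝ → ℝ) (zm zp kx : ℝ) (ς : ℂ) :
    Lp ℂ 2 (volume.restrict (cell zm zp)) →L[ℂ] Lp ℂ 2 (volume.restrict (cell zm zp)) :=
  kernelOperator (volume.restrict (cell zm zp)) (scatteringKernel ε kx ς)

/-- The formula for `Ĥ(ς)` holds for every `ς` in the cut plane: the convention for kernels that
are not square integrable is never used there. -/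
theorem scatteringOperator_apply {ε : ℝ × ℝ → ℝ} (hε : Measurable ε) {M : ℝ} (h1 : ∀ r, 1 ≤ ε r)
    (hM : ∀ r, ε r ≤ M) {kx : ℝ} {ς : ℂ} (hς : ς ∈ cutPlane kx) (zm zp : ℝ)
    (E : Lp ℂ 2 (volume.restrict (cell zm zp))) :
    scatteringOperator ε zm zp kx ς E =ᵐ[volume.restrict (cell zm zp)]
      fun r => ∫ r₀ in cell zm zp, ((ε r₀ : ℂ) - 1) * greenKernel kx ς (r - r₀) * E r₀ :=
  kernelOperator_apply (memLp_scatteringKernel hε h1 hM hς zm zp) E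

/-- The generalized resolvent `ς ↦ [1 - Ĥ(ς)]⁻¹` with values in the bounded operators on `L²(D)`
(by convention `0` at the points where `1 - Ĥ(ς)` has no bounded inverse). -/
noncomputable def generalizedResolvent (ε : ℝ × ℝ → ℝ) (zm zp kx : ℝ) (ς : ℂ) :
    Lp ℂ 2 (volume.restrict (cell zm zp)) →L[ℂ] Lp ℂ 2 (volume.restrict (cell zm zp)) :=
  Ring.inverse (1 - scatteringOperator ε zm zp kx ς)

/-- `ς` is a pole, in the cut plane, of the generalized resolvent. -/
def IsResonancePole (ε : ℝ × ℝ → ℝ) (zm zp kx : ℝ) (ς : ℂ) : Prop :=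
  ς ∈ cutPlane kx ∧ meromorphicOrderAt (generalizedResolvent ε zm zp kx) ς < 0

/-- `E` is a nonzero solution of the generalized eigenvalue problem `Ĥ(ς) E = E` in `L²(D)`. -/
def IsSiegertState (ε : ℝ × ℝ → ℝ) (zm zp kx : ℝ) (ς : ℂ)
    (E : Lp ℂ 2 (volume.restrict (cell zm zp))) : Prop :=
  E ≠ 0 ∧ scatteringOperator ε zm zp kx ς E = E

/-- The width `Γ` in the decomposition `ς = k² - iΓ`. -/
def resonanceWidth (ς : ℂ) : ℝ := -ς.im

/-- The extension of a Siegert state `E ∈ L²(D)` to the whole plane through the equation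
`E(r) = ∫_D (ε(r₀) - 1) H(ς; r - r₀) E(r₀) dr₀`. -/
noncomputable def siegertField (ε : ℝ × ℝ → ℝ) (zm zp kx : ℝ) (ς : ℂ)
    (E : Lp ℂ 2 (volume.restrict (cell zm zp))) (r : ℝ × ℝ) : ℂ :=
  ∫ r₀ in cell zm zp, ((ε r₀ : ℂ) - 1) * greenKernel kx ς (r - r₀) * E r₀

/-- `iς / (2√(ς - k_{x,m}²)) ∫_D (ε(r₀) - 1) E(r₀) exp (i (-x₀ k_{x,m} - σ z₀ √(ς - k_{x,m}²))) dr₀`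
for a sign `σ = ±1`. -/
noncomputable def scatteringAmplitude (σ : ℝ) (ε : ℝ × ℝ → ℝ) (zm zp kx : ℝ) (ς : ℂ)
    (E : Lp ℂ 2 (volume.restrict (cell zm zp))) (m : ℤ) : ℂ :=
  Complex.I * ς / (2 * zWaveNumber kx ς m) *
    ∫ r₀ in cell zm zp, ((ε r₀ : ℂ) - 1) * E r₀ *
      Complex.exp (Complex.I * (-(r₀.1 * xWaveNumber kx m) - σ * r₀.2 * zWaveNumber kx ς m))

/-- `S_m⁺`, the amplitude of the `m`-th outgoing diffraction channel in `z > zp`. -/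
noncomputable def amplitudePlus (ε : ℝ × ℝ → ℝ) (zm zp kx : ℝ) (ς : ℂ)
    (E : Lp ℂ 2 (volume.restrict (cell zm zp))) (m : ℤ) : ℂ :=
  scatteringAmplitude 1 ε zm zp kx ς E m

/-- `S_m⁻`, the amplitude of the `m`-th outgoing diffraction channel in `z < zm`. -/
noncomputable def amplitudeMinus (ε : ℝ × ℝ → ℝ) (zm zp kx : ℝ) (ς : ℂ)
    (E : Lp ℂ 2 (volume.restrict (cell zm zp))) (m : ℤ) : ℂ :=
  scatteringAmplitude (-1) ε zm zp kx ς E m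

/-- With `q = √(ς - k_{x,m}²)`, the flux of the `m`-th channel through `z = z₁` and `z = z₂`:
`Re q (|S_m⁺|² exp (-2 z₂ Im q) + |S_m⁻|² exp (2 z₁ Im q))`. -/
noncomputable def channelFlux (ε : ℝ × ℝ → ℝ) (zm zp kx : ℝ) (ς : ℂ)
    (E : Lp ℂ 2 (volume.restrict (cell zm zp))) (z₁ z₂ : ℝ) (m : ℤ) : ℝ :=
  (zWaveNumber kx ς m).re *
    (‖amplitudePlus ε zm zp kx ς E m‖ ^ 2 * Real.exp (-2 * z₂ * (zWaveNumber kx ς m).im) +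
      ‖amplitudeMinus ε zm zp kx ς E m‖ ^ 2 * Real.exp (2 * z₁ * (zWaveNumber kx ς m).im))

/-- `∫_{D'} |E|² ε` over the rectangle `D' = [0,1] × [z₁,z₂]`. -/
noncomputable def fieldEnergy (ε : ℝ × ℝ → ℝ) (zm zp kx : ℝ) (ς : ℂ)
    (E : Lp ℂ 2 (volume.restrict (cell zm zp))) (z₁ z₂ : ℝ) : ℝ :=
  ∫ r in cell z₁ z₂, ‖siegertField ε zm zp kx ς E r‖ ^ 2 * ε r

theorem finite_openChannels (kx : ℝ) (ς : ℂ) : {m : ℤ | xWaveNumber kx m ^ 2 ≤ ς.re}.Finite := by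
  refine (finite_channels kx ς.re).subset fun m hm => ?_
  have h1 : xWaveNumber kx m ^ 2 ≤ ς.re := hm
  have h2 : xWaveNumber kx m ^ 2 ≤ (m : ℝ) ^ 2 + ς.re := by linarith [sq_nonneg (m : ℝ)]
  exact h2

/-- The finite set of open diffraction channels, `{m ∈ ℤ : Re ς ≥ k_{x,m}²}`. -/
noncomputable def openChannels (kx : ℝ) (ς : ℂ) : Finset ℤ := (finite_openChannels kx ς).toFinset

end PeriodicScattering

open PeriodicScattering

namespace PeriodicScattering

/-! Poles. The operator `Ĥ(ς)` is Hilbert–Schmidt, hence compact, and it depends continuously on `ς`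
in operator norm on the cut plane. By the Fredholm alternative, either `1` is an eigenvalue or `1 -
Ĥ(ς)` is invertible. In the second case the resolvent is continuous at `ς`, whereas at a pole its
norm tends to infinity. So every pole carries a Siegert state; continuity of `Ĥ` is all that is
needed, not analyticity (`isCompactOperator_kernelOperator`, `tendsto_scatteringOperator`).

Width. The `n`-th Fourier coefficient `u` in `x` of the field satisfies `u'' + q² u = -ς f` with
outgoing ends, where `f` is the coefficient of `(ε - 1)E` (`xCoeff_greenIntegral`). The flux `Im(ū
u')` has derivative `Γ|u|² - Im(ς ū f)`. At the two ends `u' = ± i q u`, so integration gives `Re q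
(|u(z₂)|² + |u(z₁)|²)`, which is the channel flux (`outgoingWave_flux`). Summing over channels with
Parseval turns the right side into `∫ (Γ|E|² - Im ς (ε - 1)|E|²) = Γ ∫ ε|E|²`
(`hasSum_channelFlux`).

Consequences. If `Im ς > 0`, then all `Re q ≥ 0`, so the formula forces `Γ ≥ 0`, a contradiction;
hence no pole lies in the upper half plane. For closed channels `Im q > 0`, so their flux dies out
as the rectangle grows, while the energy stays bounded below by its value on `D`; only the open
channels survive in the limit (`tendsto_tsum_closedFlux`). -/

/-! ### Hilbert–Schmidt operators: compactness and norm bounds -/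

theorem eLpNorm_two_sq {X : Type*} [MeasurableSpace X] (ν : Measure X) (g : X → ℂ) :
    eLpNorm g 2 ν ^ 2 = ∫⁻ y, ‖g y‖ₑ ^ 2 ∂ν := by
  rw [eLpNorm_eq_lintegral_rpow_enorm_toReal (by norm_num) (by norm_num), ← ENNReal.rpow_natCast,
    ← ENNReal.rpow_mul]
  simp

theorem ae_memLp_two_section {X Y : Type*} [MeasurableSpace X] [MeasurableSpace Y]
    {μ : Measure X} {ν : Measure Y} [SFinite μ] [SFinite ν] {K : X × Y → ℂ}
    (hK : MemLp K 2 (μ.prod ν)) : ∀ᵐ r ∂μ, MemLp (fun r₀ => K (r, r₀)) 2 ν := by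
  have hprod : ∫⁻ r, ∫⁻ r₀, ‖K (r, r₀)‖ₑ ^ 2 ∂ν ∂μ = eLpNorm K 2 (μ.prod ν) ^ 2 := by
    rw [eLpNorm_two_sq, lintegral_prod _ (hK.1.enorm.pow_const 2)]
  have h1 : ∀ᵐ r ∂μ, ∫⁻ r₀, ‖K (r, r₀)‖ₑ ^ 2 ∂ν < ∞ := by
    refine ae_lt_top' ((hK.1.enorm.pow_const 2).lintegral_prod_right') ?_
    rw [hprod]
    exact ENNReal.pow_ne_top hK.2.ne
  filter_upwards [h1, hK.1.prodMk_left] with r h2 h3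
  refine ⟨h3, ?_⟩
  rw [← eLpNorm_two_sq] at h2
  exact (ENNReal.pow_lt_top_iff.1 h2).resolve_right (by norm_num)

/-- For almost every `r`, the value at `r` of the operator applied to `e i` is an inner product with
the conjugated section `K(r, ·)`. Bessel's inequality for this section, integrated over `r`, gives
the bound. -/
theorem sum_enorm_sq_kernelOperator_le {X ι : Type*} [MeasurableSpace X] {μ : Measure X} [SFinite μ]
    {K : X × X → ℂ} (hK : MemLp K 2 (μ.prod μ)) {e : ι → Lp ℂ 2 μ} (he : Orthonormal ℂ e)
    (s : Finset ι) :
    ∑ i ∈ s, ‖kernelOperator μ K (e i)‖ₑ ^ 2 ≤ eLpNorm K 2 (μ.prod μ) ^ 2 := by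
  have h1 : ∀ i, ‖kernelOperator μ K (e i)‖ₑ ^ 2
      = ∫⁻ r, ‖∫ r₀, K (r, r₀) * e i r₀ ∂μ‖ₑ ^ 2 ∂μ := by
    intro i
    rw [Lp.enorm_def, eLpNorm_two_sq]
    refine lintegral_congr_ae ?_
    filter_upwards [kernelOperator_apply hK (e i)] with r hr
    rw [hr]
  have hm : ∀ i, AEMeasurable (fun r => ‖∫ r₀, K (r, r₀) * e i r₀ ∂μ‖ₑ ^ 2) μ := fun i =>
    ((memLp_kernel_apply hK (e i)).2.1.1.enorm.pow_const 2)
  simp_rw [h1]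
  rw [← lintegral_finsetSum' _ (fun i _ => hm i), eLpNorm_two_sq,
    lintegral_prod _ (hK.1.enorm.pow_const 2)]
  refine lintegral_mono_ae ?_
  filter_upwards [ae_memLp_two_section hK] with r hr
  have hc : MemLp (fun r₀ => (starRingEnd ℂ) (K (r, r₀))) 2 μ := hr.star
  set κ : Lp ℂ 2 μ := hc.toLp with hκ
  have h2 : ∀ i, ‖∫ r₀, K (r, r₀) * e i r₀ ∂μ‖ = ‖inner ℂ (e i) κ‖ := by
    intro i
    rw [norm_inner_symm, L2.inner_def]
    congr 1
    refine integral_congr_ae ?_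
    filter_upwards [hc.coeFn_toLp] with r₀ h
    rw [hκ, h]
    simp [mul_comm]
  have h3 := he.sum_inner_products_le κ (s := s)
  have h4 : ‖κ‖ₑ ^ 2 = ∫⁻ y, ‖K (r, y)‖ₑ ^ 2 ∂μ := by
    rw [Lp.enorm_def, eLpNorm_two_sq]
    refine lintegral_congr_ae ?_
    filter_upwards [hc.coeFn_toLp] with r₀ h
    rw [hκ, h]
    simp [← ofReal_norm]
  rw [← h4]
  have h5 : ∀ i, ‖∫ r₀, K (r, r₀) * e i r₀ ∂μ‖ₑ ^ 2 = ENNReal.ofReal (‖inner ℂ (e i) κ‖ ^ 2) := by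
    intro i
    rw [← ofReal_norm, h2, ENNReal.ofReal_pow (norm_nonneg _)]
  simp_rw [h5]
  rw [← ENNReal.ofReal_sum_of_nonneg (fun _ _ => sq_nonneg _), ← ofReal_norm,
    ← ENNReal.ofReal_pow (norm_nonneg _)]
  exact ENNReal.ofReal_le_ofReal h3

/-- A bounded operator on a Hilbert space whose values on a Hilbert basis have summable squared
norms is compact. -/
theorem isCompactOperator_of_summable_sq {ι H : Type*} [NormedAddCommGroup H]
    [InnerProductSpace ℂ H] [CompleteSpace H] (b : HilbertBasis ι ℂ H) (T : H →L[ℂ] H)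
    (hT : Summable fun i => ‖T (b i)‖ ^ 2) : IsCompactOperator T := by
  classical
  -- Finite-rank truncations; the tail estimate below shows that they converge to `T` in operator
  -- norm.
  let S : Finset ι → H →L[ℂ] H := fun s =>
    ∑ i ∈ s, (innerSL ℂ (b i)).smulRight (T (b i))
  have hS : ∀ s f, S s f = ∑ i ∈ s, inner ℂ (b i) f • T (b i) := by
    intro s f
    simp [S]
  have hcomp : ∀ s, IsCompactOperator (S s) := by
    intro s
    refine Submodule.sum_mem (compactOperator (RingHom.id ℂ) H H) (t := s)
      (f := fun i => (innerSL ℂ (b i)).smulRight (T (b i))) fun i _ => ?_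
    change IsCompactOperator _
    exact (isCompactOperator_of_locallyCompactSpace_rng
      (ContinuousLinearMap.toSpanSingleton ℂ (T (b i)))).comp_clm (innerSL ℂ (b i))
  refine isCompactOperator_of_tendsto (l := Filter.atTop) (F := S) ?_ (.of_forall hcomp)
  rw [Metric.tendsto_atTop]
  intro δ hδ
  obtain ⟨s, hs⟩ := summable_iff_vanishing_norm.1 hT ((δ / 2) ^ 2) (by positivity)
  refine ⟨s, fun t hst => ?_⟩
  rw [dist_eq_norm, norm_sub_rev]
  refine lt_of_le_of_lt ?_ (half_lt_self hδ)
  refine ContinuousLinearMap.opNorm_le_bound _ (by positivity) fun f => ?_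
  have hsum : HasSum (fun i => inner ℂ (b i) f • T (b i)) (T f) := by
    have h := (b.hasSum_repr f).mapL T
    simpa only [map_smul, b.repr_apply_apply] using h
  -- The bound on `T f - S t f` is obtained for finite partial sums beyond `t` and passed to the
  -- limit.
  have htend : Filter.Tendsto (fun u : Finset ι => ‖∑ i ∈ u, inner ℂ (b i) f • T (b i) - S t f‖)
      Filter.atTop (nhds ‖T f - S t f‖) := (hsum.sub_const _).norm
  rw [_root_.sub_apply]
  refine le_of_tendsto htend ?_
  filter_upwards [Filter.eventually_ge_atTop t] with u hu
  rw [hS, ← Finset.sum_sdiff hu, add_sub_cancel_right]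
  have hd : Disjoint (u \ t) s := Finset.disjoint_of_subset_right hst Finset.sdiff_disjoint
  have h1 := (le_abs_self _).trans (hs _ hd).le
  have h2 := b.orthonormal.sum_inner_products_le f (s := u \ t)
  refine abs_le_of_sq_le_sq' ?_ (by positivity) |>.2
  -- Cauchy–Schwarz splits the tail into a Bessel factor for `f` and the tail of the summable
  -- squares.
  calc ‖∑ i ∈ u \ t, inner ℂ (b i) f • T (b i)‖ ^ 2
      ≤ (∑ i ∈ u \ t, ‖inner ℂ (b i) f‖ * ‖T (b i)‖) ^ 2 := by
        gcongr
        refine (norm_sum_le _ _).trans (le_of_eq ?_)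
        simp_rw [norm_smul]
    _ ≤ (∑ i ∈ u \ t, ‖inner ℂ (b i) f‖ ^ 2) * ∑ i ∈ u \ t, ‖T (b i)‖ ^ 2 :=
        Finset.sum_mul_sq_le_sq_mul_sq _ _ _
    _ ≤ ‖f‖ ^ 2 * (δ / 2) ^ 2 := by gcongr
    _ = (δ / 2 * ‖f‖) ^ 2 := by ring

theorem isCompactOperator_kernelOperator {X : Type*} [MeasurableSpace X] {μ : Measure X}
    [SFinite μ] {K : X × X → ℂ} (hK : MemLp K 2 (μ.prod μ)) :
    IsCompactOperator (kernelOperator μ K) := by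
  obtain ⟨w, b, -⟩ := exists_hilbertBasis ℂ (Lp ℂ 2 μ)
  refine isCompactOperator_of_summable_sq b _ ?_
  refine summable_of_sum_le (c := (eLpNorm K 2 (μ.prod μ) ^ 2).toReal) (fun _ => sq_nonneg _)
    fun s => ?_
  have h := sum_enorm_sq_kernelOperator_le hK b.orthonormal s
  have h2 := ENNReal.toReal_mono (ENNReal.pow_ne_top hK.2.ne) h
  rw [ENNReal.toReal_sum (fun i _ => ENNReal.pow_ne_top enorm_ne_top)] at h2
  simpa using h2

/-- Reduces norm continuity of the operators to convergence of their kernels in `L²(μ × μ)`. -/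
theorem norm_kernelOperator_sub_le {X : Type*} [MeasurableSpace X] {μ : Measure X}
    [SFinite μ] {K₁ K₂ : X × X → ℂ} (h1 : MemLp K₁ 2 (μ.prod μ)) (h2 : MemLp K₂ 2 (μ.prod μ)) :
    ‖kernelOperator μ K₁ - kernelOperator μ K₂‖
      ≤ (eLpNorm (K₁ - K₂) 2 (μ.prod μ)).toReal := by
  refine ContinuousLinearMap.opNorm_le_bound _ ENNReal.toReal_nonneg fun f => ?_
  have h3 := memLp_kernel_apply (h1.sub h2) f
  rw [Lp.norm_def, Lp.norm_def, ← ENNReal.toReal_mul]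
  refine ENNReal.toReal_mono (ENNReal.mul_lt_top (h1.sub h2).2 (Lp.eLpNorm_lt_top f)).ne ?_
  refine le_trans (le_of_eq ?_) h3.2.2
  refine eLpNorm_congr_ae ?_
  rw [_root_.sub_apply]
  filter_upwards [Lp.coeFn_sub (kernelOperator μ K₁ f) (kernelOperator μ K₂ f),
    kernelOperator_apply h1 f, kernelOperator_apply h2 f, (memLp_kernel_apply h1 f).1,
    (memLp_kernel_apply h2 f).1] with r e1 e2 e3 i1 i2
  rw [e1, Pi.sub_apply, e2, e3, ← integral_sub i1 i2]
  refine integral_congr_ae (.of_forall fun r₀ => ?_)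
  simp [sub_mul]

/-! ### Locally uniform kernel bounds and norm continuity of `Ĥ` -/

theorem measurableSet_cell (a b : ℝ) : MeasurableSet (cell a b) :=
  measurableSet_Icc.prod measurableSet_Icc

theorem restrict_cell (a b : ℝ) : (volume.restrict (cell a b) : Measure (ℝ × ℝ)) =
    (volume.restrict (Set.Icc 0 1)).prod (volume.restrict (Set.Icc a b)) := by
  rw [Measure.prod_restrict, cell, Measure.volume_eq_prod]

instance isFiniteMeasure_restrict_cell (a b : ℝ) :
    IsFiniteMeasure (volume.restrict (cell a b) : Measure (ℝ × ℝ)) := by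
  rw [restrict_cell]
  infer_instance

theorem enorm_abs_rpow_neg_quarter_sq (t : ℝ) :
    ‖|t| ^ (-(1 / 4) : ℝ)‖ₑ ^ 2 = ENNReal.ofReal (|t| ^ (-(1 / 2) : ℝ)) := by
  rw [Real.enorm_of_nonneg (by positivity), ← ENNReal.ofReal_pow (by positivity),
    ← Real.rpow_natCast, ← Real.rpow_mul (abs_nonneg t)]
  norm_num

/-- The squared singularity `|t|^(-1/2)` is integrable, and for every `z` in `[a,b]` the translate
`z - [a,b]` stays in `[-L, L]`. Hence one constant serves all `z`. -/
theorem exists_lintegral_abs_sub_rpow_le (a b : ℝ) :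
    ∃ C : ℝ≥0∞, C < ∞ ∧ ∀ z ∈ Set.Icc a b,
      ∫⁻ r₀ in cell a b, ‖|z - r₀.2| ^ (-(1 / 4) : ℝ)‖ₑ ^ 2 ≤ C := by
  set L := |b - a| with hL
  refine ⟨∫⁻ t in Set.Icc (-L) L, ENNReal.ofReal (|t| ^ (-(1 / 2) : ℝ)), ?_, fun z hz => ?_⟩
  · exact ((intervalIntegrable_iff_integrableOn_Icc_of_le
      (by linarith [abs_nonneg (b - a)])).1
      (intervalIntegrable_abs_rpow L (abs_nonneg _))).lintegral_lt_top
  · simp_rw [enorm_abs_rpow_neg_quarter_sq]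
    rw [restrict_cell, lintegral_prod _ (by fun_prop)]
    simp only [lintegral_const, Measure.restrict_apply_univ, Real.volume_Icc, sub_zero,
      ENNReal.ofReal_one, mul_one]
    rw [← lintegral_indicator measurableSet_Icc, ← lintegral_indicator measurableSet_Icc,
      ← lintegral_sub_left_eq_self
        (f := (Set.Icc (-L) L).indicator fun t => ENNReal.ofReal (|t| ^ (-(1 / 2) : ℝ))) z]
    refine lintegral_mono fun t => ?_
    by_cases ht : t ∈ Set.Icc a b
    · rw [Set.indicator_of_mem ht, Set.indicator_of_mem]
      rw [hL, abs_of_nonneg (by linarith [hz.1, hz.2])]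
      constructor <;> linarith [hz.1, hz.2, ht.1, ht.2]
    · rw [Set.indicator_of_notMem ht]
      exact zero_le

theorem memLp_abs_sub_rpow {a b z : ℝ} (hz : z ∈ Set.Icc a b) :
    MemLp (fun r₀ : ℝ × ℝ => |z - r₀.2| ^ (-(1 / 4) : ℝ)) 2 (volume.restrict (cell a b)) := by
  refine ⟨Measurable.aestronglyMeasurable (by fun_prop), ?_⟩
  obtain ⟨C, hC, h⟩ := exists_lintegral_abs_sub_rpow_le a b
  rw [eLpNorm_lt_top_iff_lintegral_rpow_enorm_lt_top (by norm_num) (by norm_num)]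
  simpa using (h z hz).trans_lt hC

theorem memLp_prod_abs_sub_rpow (a b : ℝ) :
    MemLp (fun p : (ℝ × ℝ) × (ℝ × ℝ) => |p.1.2 - p.2.2| ^ (-(1 / 4) : ℝ)) 2
      ((volume.restrict (cell a b)).prod (volume.restrict (cell a b))) := by
  refine ⟨Measurable.aestronglyMeasurable (by fun_prop), ?_⟩
  obtain ⟨C, hC, h⟩ := exists_lintegral_abs_sub_rpow_le a b
  rw [eLpNorm_lt_top_iff_lintegral_rpow_enorm_lt_top (by norm_num) (by norm_num),
    lintegral_prod _ (by fun_prop)]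
  simp only [ENNReal.toReal_ofNat, ENNReal.rpow_ofNat]
  refine (setLIntegral_mono' (measurableSet_cell a b) fun r hr => h r.2 hr.2).trans_lt ?_
  rw [lintegral_const]
  exact ENNReal.mul_lt_top hC (measure_lt_top _ _)

theorem ae_snd_ne (z : ℝ) : ∀ᵐ r₀ : ℝ × ℝ, z ≠ r₀.2 := by
  have e : {r₀ : ℝ × ℝ | ¬ z ≠ r₀.2} = Set.univ ×ˢ {z} := by
    ext x
    simp [eq_comm]
  rw [ae_iff, e, Measure.volume_eq_prod, Measure.prod_prod]
  simp

theorem continuousAt_cutSqrt {w : ℂ} (hw : -Complex.I * w ∈ Complex.slitPlane) :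
    ContinuousAt cutSqrt w := by
  have h0 : w ≠ 0 := by
    rintro rfl
    simp at hw
  have h1 : ContinuousAt (fun w => Complex.exp (cutLog w / 2)) w := by
    unfold cutLog
    fun_prop (disch := assumption)
  refine h1.congr ?_
  filter_upwards [isOpen_ne.mem_nhds h0] with v hv
  rw [cutSqrt, if_neg hv]

theorem continuousAt_zWaveNumber {kx : ℝ} {ς : ℂ} (hς : ς ∈ cutPlane kx) (m : ℤ) :
    ContinuousAt (fun ς => zWaveNumber kx ς m) ς := by
  unfold zWaveNumber
  refine ContinuousAt.comp (g := cutSqrt) ?_ (by fun_prop)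
  refine continuousAt_cutSqrt ?_
  rw [Complex.mem_slitPlane_iff_not_le_zero]
  intro h
  obtain ⟨h1, h2⟩ := Complex.le_def.1 h
  simp only [Complex.mul_re, Complex.mul_im, Complex.neg_re, Complex.neg_im, Complex.I_re,
    Complex.I_im, Complex.sub_re, Complex.sub_im, Complex.ofReal_re, Complex.ofReal_im,
    Complex.zero_re, Complex.zero_im] at h1 h2
  -- If the radicand lay on the branch cut, then `ς = k_{x,m}² - is` with `s = -Im ς ≥ 0`, a removed
  -- point.
  refine hς m (-ς.im) (by linarith) ?_
  apply Complex.ext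
  · rw [Complex.sub_re, Complex.ofReal_re, Complex.I_mul_re, Complex.ofReal_im]
    linarith
  · rw [Complex.sub_im, Complex.ofReal_im, Complex.I_mul_im, Complex.ofReal_re]
    ring

/-- A version of `exists_channel_bound` whose majorant does not depend on `ς` near `ς₀`, as
dominated convergence requires. For all but finitely many `m` the estimate `|m| ≤ Im q` uses only
the upper bound `Re ς < Re ς₀ + 1`. The remaining channels are controlled by continuity of `q` in
`ς`. -/
theorem exists_channel_bound_nhds {kx : ℝ} {ς₀ : ℂ} (hς₀ : ς₀ ∈ cutPlane kx) (L : ℝ) :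
    ∃ A : ℤ → ℝ, Summable A ∧ ∀ᶠ ς in nhds ς₀, ∀ m : ℤ, ∀ z : ℝ, 0 < |z| → |z| ≤ L →
      Real.exp (-(|z| * (zWaveNumber kx ς m).im)) / ‖zWaveNumber kx ς m‖
        ≤ A m * |z| ^ (-(1 / 4) : ℝ) := by
  classical
  -- The exceptional channels; `0` is included because the majorant outside `N` contains `|m|⁻¹`.
  let N : Set ℤ := {m : ℤ | xWaveNumber kx m ^ 2 ≤ (m : ℝ) ^ 2 + (ς₀.re + 1)} ∪ {0}
  have hN : N.Finite := (finite_channels kx _).union (Set.finite_singleton 0)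
  let q₀ := zWaveNumber kx ς₀
  have hq0 : ∀ m, 0 < ‖q₀ m‖ := fun m => norm_pos_iff.2 (zWaveNumber_ne_zero hς₀ m)
  have hev1 : ∀ᶠ ς in nhds ς₀, ς.re < ς₀.re + 1 :=
    Complex.continuous_re.continuousAt.eventually_lt continuousAt_const (by simp)
  have hev2 : ∀ᶠ ς in nhds ς₀, ∀ m ∈ N,
      Real.exp (L * ‖zWaveNumber kx ς m‖) / ‖zWaveNumber kx ς m‖
        < Real.exp (L * ‖q₀ m‖) / ‖q₀ m‖ + 1 := by
    rw [Filter.eventually_all_finite hN]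
    intro m _
    have hc := (continuousAt_zWaveNumber hς₀ m).norm
    have hc2 : ContinuousAt (fun ς => Real.exp (L * ‖zWaveNumber kx ς m‖)
        / ‖zWaveNumber kx ς m‖) ς₀ :=
      (Real.continuous_exp.continuousAt.comp (hc.const_mul L)).div hc (hq0 m).ne'
    exact hc2.eventually_lt continuousAt_const (by simp [q₀])
  refine ⟨fun m => if m ∈ N then L ^ (1 / 4 : ℝ) * (Real.exp (L * ‖q₀ m‖) / ‖q₀ m‖ + 1)
    else (|(m : ℝ)| / 2) ^ (-(1 / 4) : ℝ) * |(m : ℝ)| ^ (-1 : ℝ), ?_, ?_⟩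
  · have hs : Summable fun m : ℤ => (1 / 2 : ℝ) ^ (-(1 / 4) : ℝ) * |(m : ℝ)| ^ (-(5 / 4) : ℝ) :=
      (Real.summable_abs_int_rpow (by norm_num)).mul_left _
    refine summable_of_isBigO hs (Filter.EventuallyEq.isBigO ?_)
    filter_upwards [hN.compl_mem_cofinite] with m hm
    have hm0 : m ≠ 0 := fun h => hm (Or.inr h)
    have hm' : 0 < |(m : ℝ)| := abs_pos.2 (by exact_mod_cast hm0)
    rw [if_neg hm, div_eq_mul_one_div, Real.mul_rpow hm'.le (by norm_num),
      show (-(5 / 4) : ℝ) = -(1 / 4) + -1 by norm_num, Real.rpow_add hm']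
    ring
  · filter_upwards [hev1, hev2] with ς h1 h2 m z hz hzL
    set q := zWaveNumber kx ς with hq
    by_cases hm : m ∉ N
    · rw [if_neg hm]
      have hm0 : m ≠ 0 := fun h => hm (Or.inr h)
      have hm1 : (m : ℝ) ^ 2 + (ς₀.re + 1) < xWaveNumber kx m ^ 2 := by
        by_contra! hcon
        exact hm (Or.inl hcon)
      have hm' : 0 < |(m : ℝ)| := abs_pos.2 (by exact_mod_cast hm0)
      have h4 : (q m) ^ 2 = ς - ((xWaveNumber kx m ^ 2 : ℝ) : ℂ) := cutSqrt_sq _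
      have h5 : (q m).re * (q m).re - (q m).im * (q m).im = ς.re - xWaveNumber kx m ^ 2 := by
        have h := congrArg Complex.re h4
        rw [sq, Complex.mul_re, Complex.sub_re, Complex.ofReal_re] at h
        exact h
      have h6 : 0 < (q m).im := by
        refine cutSqrt_im_pos ?_
        rw [Complex.sub_re, Complex.ofReal_re]
        nlinarith [sq_nonneg (m : ℝ)]
      have h7 : |(m : ℝ)| ≤ (q m).im := by
        refine abs_le_of_sq_le_sq ?_ h6.le
        nlinarith [mul_self_nonneg (q m).re]
      have h8 : |(m : ℝ)| ≤ ‖q m‖ := h7.trans ((le_abs_self _).trans (Complex.abs_im_le_norm _))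
      -- The exponent `-1/4` is a compromise: a factor `|m|^(-1/4)` joins `|m|⁻¹` to give a summable
      -- series, and `|z|^(-1/4)` is still locally square integrable.
      have h9 : Real.exp (-(|z| * (q m).im)) ≤ (|z| * (|(m : ℝ)| / 2)) ^ (-(1 / 4) : ℝ) := by
        refine le_trans (Real.exp_le_exp.2 ?_) (exp_neg_le_rpow (by positivity))
        exact neg_le_neg (mul_le_mul_of_nonneg_left (by linarith) hz.le)
      rw [Real.mul_rpow hz.le (by positivity)] at h9
      rw [Real.rpow_neg_one, div_eq_mul_inv]
      calc _ ≤ (|z| ^ (-(1 / 4) : ℝ) * (|(m : ℝ)| / 2) ^ (-(1 / 4) : ℝ)) * |(m : ℝ)|⁻¹ := by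
            gcongr
        _ = _ := by ring
    · rw [if_pos (not_not.1 hm)]
      have h3 := (h2 m (not_not.1 hm)).le
      have h4 : Real.exp (-(|z| * (q m).im)) ≤ Real.exp (L * ‖q m‖) := by
        refine Real.exp_le_exp.2 ?_
        have h2 := neg_abs_le (q m).im
        have h3 := Complex.abs_im_le_norm (q m)
        nlinarith [abs_nonneg z, norm_nonneg (q m)]
      -- Exceptional channels have no singularity at `z = 0`; this factor, at least `1` for `|z| ≤
      -- L`, brings their bound to the common form.
      have h5 : 1 ≤ L ^ (1 / 4 : ℝ) * |z| ^ (-(1 / 4) : ℝ) := by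
        rw [Real.rpow_neg hz.le, ← div_eq_mul_inv, one_le_div (by positivity)]
        exact Real.rpow_le_rpow hz.le hzL (by norm_num)
      have h6 : 0 ≤ Real.exp (L * ‖q₀ m‖) / ‖q₀ m‖ + 1 := by positivity
      calc Real.exp (-(|z| * (q m).im)) / ‖q m‖ ≤ Real.exp (L * ‖q m‖) / ‖q m‖ := by gcongr
        _ ≤ 1 * (Real.exp (L * ‖q₀ m‖) / ‖q₀ m‖ + 1) := by rw [one_mul]; exact h3
        _ ≤ (L ^ (1 / 4 : ℝ) * |z| ^ (-(1 / 4) : ℝ)) * (Real.exp (L * ‖q₀ m‖) / ‖q₀ m‖ + 1) := by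
            gcongr
        _ = _ := by ring

theorem exists_greenKernel_bound_nhds {kx : ℝ} {ς₀ : ℂ} (hς₀ : ς₀ ∈ cutPlane kx) (L : ℝ) :
    ∃ C : ℝ, 0 ≤ C ∧ ∀ᶠ ς in nhds ς₀, ∀ r : ℝ × ℝ, 0 < |r.2| → |r.2| ≤ L →
      ‖greenKernel kx ς r‖ ≤ C * |r.2| ^ (-(1 / 4) : ℝ) := by
  obtain ⟨A, hA, hb⟩ := exists_channel_bound_nhds hς₀ L
  have hev : ∀ᶠ ς in nhds ς₀, ‖Complex.I * ς / 2‖ < ‖Complex.I * ς₀ / 2‖ + 1 :=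
    ContinuousAt.eventually_lt (by fun_prop) continuousAt_const (by simp)
  refine ⟨(‖Complex.I * ς₀ / 2‖ + 1) * |∑' m, A m|, by positivity, ?_⟩
  filter_upwards [hb, hev] with ς hb hς r h1 h2
  rw [greenKernel, norm_mul]
  have h3 := tsum_of_norm_bounded (hA.mul_right (|r.2| ^ (-(1 / 4) : ℝ))).hasSum
    (fun m => (norm_channel_term kx ς r m).trans_le (hb m r.2 h1 h2))
  rw [tsum_mul_right] at h3
  calc _ ≤ (‖Complex.I * ς₀ / 2‖ + 1) * (|∑' m, A m| * |r.2| ^ (-(1 / 4) : ℝ)) := by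
        gcongr
        exact h3.trans (by gcongr; exact le_abs_self _)
    _ = _ := by ring

theorem tendsto_greenKernel {kx : ℝ} {ς₀ : ℂ} (hς₀ : ς₀ ∈ cutPlane kx) {r : ℝ × ℝ}
    (hr : r.2 ≠ 0) :
    Filter.Tendsto (fun ς => greenKernel kx ς r) (nhds ς₀) (nhds (greenKernel kx ς₀ r)) := by
  obtain ⟨A, hA, hb⟩ := exists_channel_bound_nhds hς₀ |r.2|
  unfold greenKernel
  refine Filter.Tendsto.mul (Continuous.tendsto (by fun_prop) _) ?_
  refine tendsto_tsum_of_dominated_convergence (hA.mul_right (|r.2| ^ (-(1 / 4) : ℝ))) ?_ ?_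
  · intro m
    have hq : Filter.Tendsto (fun ς => zWaveNumber kx ς m) (nhds ς₀)
      (nhds (zWaveNumber kx ς₀ m)) := continuousAt_zWaveNumber hς₀ m
    refine Filter.Tendsto.div ?_ hq (zWaveNumber_ne_zero hς₀ m)
    refine (Complex.continuous_exp.tendsto _).comp ?_
    exact ((hq.const_mul _).const_add _).const_mul _
  · filter_upwards [hb] with ς hb m
    exact (norm_channel_term kx ς r m).trans_le (hb m r.2 (abs_pos.2 hr) le_rfl)

theorem measurable_scatteringKernel {ε : ℝ × ℝ → ℝ} (hε : Measurable ε) (kx : ℝ) (ς : ℂ) :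
    Measurable (scatteringKernel ε kx ς) := by
  unfold scatteringKernel
  have := measurable_greenKernel kx ς
  fun_prop

theorem norm_contrast_le {ε : ℝ × ℝ → ℝ} {M : ℝ} (h1 : ∀ r, 1 ≤ ε r)
    (hM : ∀ r, ε r ≤ M) (r : ℝ × ℝ) : ‖(ε r : ℂ) - 1‖ ≤ M - 1 := by
  rw [← Complex.ofReal_one, ← Complex.ofReal_sub, Complex.norm_real, Real.norm_eq_abs,
    abs_of_nonneg (by linarith [h1 r])]
  linarith [hM r]

/-- Dominated convergence in `L²(D × D)`: the kernels converge off the null set where the two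
heights coincide, and near `ς₀` they are all bounded by a fixed multiple of `|z - z₀|^(-1/4)`. -/
theorem tendsto_scatteringOperator {ε : ℝ × ℝ → ℝ} (hε : Measurable ε) {M : ℝ}
    (h1 : ∀ r, 1 ≤ ε r) (hM : ∀ r, ε r ≤ M) {kx : ℝ} {ς₀ : ℂ} (hς₀ : ς₀ ∈ cutPlane kx)
    (a b : ℝ) :
    Filter.Tendsto (scatteringOperator ε a b kx) (nhds ς₀)
      (nhds (scatteringOperator ε a b kx ς₀)) := by
  set μ : Measure (ℝ × ℝ) := volume.restrict (cell a b) with hμ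
  obtain ⟨C, hC, hb⟩ := exists_greenKernel_bound_nhds hς₀ |b - a|
  set B : ℝ := (M - 1) * C with hB
  set Φ : (ℝ × ℝ) × (ℝ × ℝ) → ℝ := fun p => B * |p.1.2 - p.2.2| ^ (-(1 / 4) : ℝ) with hΦ
  have hΦL : MemLp Φ 2 (μ.prod μ) := (memLp_prod_abs_sub_rpow a b).const_mul B
  have hne : ∀ᵐ p ∂(μ.prod μ), p.1.2 ≠ p.2.2 ∧ p.1 ∈ cell a b ∧ p.2 ∈ cell a b := by
    have e1 : ∀ᵐ p ∂(μ.prod μ), p.1.2 ≠ p.2.2 := by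
      have hms : MeasurableSet {p : (ℝ × ℝ) × (ℝ × ℝ) | p.1.2 ≠ p.2.2} :=
        (measurableSet_eq_fun (f := fun p : (ℝ × ℝ) × (ℝ × ℝ) => p.1.2)
          (g := fun p => p.2.2) (by fun_prop) (by fun_prop)).compl
      rw [Measure.ae_prod_iff_ae_ae hms]
      exact .of_forall fun r => ae_restrict_of_ae (ae_snd_ne r.2)
    have e2 : ∀ᵐ r ∂μ, r ∈ cell a b := ae_restrict_mem (measurableSet_cell a b)
    filter_upwards [e1, Measure.quasiMeasurePreserving_fst.ae e2,
      Measure.quasiMeasurePreserving_snd.ae e2] with p h1 h2 h3 using ⟨h1, h2, h3⟩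
  have hbd : ∀ᶠ ς in nhds ς₀, ∀ᵐ p ∂(μ.prod μ), ‖scatteringKernel ε kx ς p‖ ≤ Φ p := by
    filter_upwards [hb] with ς hb
    filter_upwards [hne] with p ⟨hp, hp1, hp2⟩
    have h3 := hb (p.1 - p.2) (abs_pos.2 (sub_ne_zero.2 hp)) (by
      have := hp1.2; have := hp2.2
      rw [Set.mem_Icc] at *
      rw [abs_of_nonneg (by linarith : 0 ≤ b - a), Prod.snd_sub, abs_le]
      constructor <;> linarith)
    simp only [scatteringKernel, norm_mul, hΦ, hB, mul_assoc]
    have h4 := norm_contrast_le h1 hM p.2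
    exact mul_le_mul h4 h3 (norm_nonneg _) ((norm_nonneg _).trans h4)
  have hmem : ∀ᶠ ς in nhds ς₀, MemLp (scatteringKernel ε kx ς) 2 (μ.prod μ) := by
    filter_upwards [hbd] with ς h
    exact hΦL.mono' (measurable_scatteringKernel hε kx ς).aestronglyMeasurable h
  have hlim : Filter.Tendsto (fun ς => eLpNorm (scatteringKernel ε kx ς - scatteringKernel ε kx ς₀)
      2 (μ.prod μ) ^ 2) (nhds ς₀) (nhds 0) := by
    simp_rw [eLpNorm_two_sq]
    have h0 : ∫⁻ _ : (ℝ × ℝ) × (ℝ × ℝ), (0 : ℝ≥0∞) ∂(μ.prod μ) = 0 := lintegral_zero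
    rw [← h0]
    refine tendsto_lintegral_filter_of_dominated_convergence (fun p => ‖2 * Φ p‖ₑ ^ 2) ?_ ?_ ?_ ?_
    · refine .of_forall fun ς => ?_
      exact ((measurable_scatteringKernel hε kx ς).sub
        (measurable_scatteringKernel hε kx ς₀)).enorm.pow_const 2
    · filter_upwards [hbd] with ς h
      filter_upwards [h, hbd.self_of_nhds] with p h2 h3
      gcongr
      rw [enorm_le_iff_norm_le]
      refine (norm_sub_le _ _).trans ?_
      exact (by linarith : _ ≤ 2 * Φ p).trans (le_abs_self _)
    · have h5 := (hΦL.const_mul 2).2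
      rw [eLpNorm_lt_top_iff_lintegral_rpow_enorm_lt_top (by norm_num) (by norm_num)] at h5
      simpa using h5.ne
    · filter_upwards [hne] with p hp
      have h6 := (tendsto_greenKernel (r := p.1 - p.2) hς₀ (sub_ne_zero.2 hp.1)).const_mul
        ((ε p.2 : ℂ) - 1)
      have h7 := (ENNReal.continuous_pow 2).tendsto _ |>.comp
        ((h6.sub_const (scatteringKernel ε kx ς₀ p)).enorm)
      simpa [scatteringKernel, Function.comp_def] using h7
  have hlim2 : Filter.Tendsto (fun ς => (eLpNorm (scatteringKernel ε kx ς
      - scatteringKernel ε kx ς₀) 2 (μ.prod μ)).toReal) (nhds ς₀) (nhds 0) := by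
    -- The square root is taken to return from squared norms to norms.
    have h8 := (ENNReal.continuous_rpow_const (y := (1 / 2 : ℝ))).tendsto 0 |>.comp hlim
    have h9 : ∀ x : ℝ≥0∞, (x ^ 2) ^ (1 / 2 : ℝ) = x := by
      intro x
      rw [← ENNReal.rpow_natCast, ← ENNReal.rpow_mul]
      norm_num
    simp only [Function.comp_def, h9] at h8
    rw [ENNReal.zero_rpow_of_pos (by norm_num)] at h8
    simpa [Function.comp_def] using (ENNReal.tendsto_toReal ENNReal.zero_ne_top).comp h8
  rw [tendsto_iff_norm_sub_tendsto_zero]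
  refine squeeze_zero' (.of_forall fun _ => norm_nonneg _) ?_ hlim2
  filter_upwards [hmem] with ς h
  exact norm_kernelOperator_sub_le h hmem.self_of_nhds

/-! ### From poles to Siegert states -/

/-- At a pole of the generalized resolvent the operator `Ĥ(ς)` has the eigenvalue `1`. -/
theorem exists_isSiegertState_of_isResonancePole {ε : ℝ × ℝ → ℝ} (hε : Measurable ε) {M : ℝ}
    (h1 : ∀ r, 1 ≤ ε r) (hM : ∀ r, ε r ≤ M) {zm zp kx : ℝ} {ς : ℂ}
    (h : IsResonancePole ε zm zp kx ς) :
    ∃ E : Lp ℂ 2 (volume.restrict (cell zm zp)), IsSiegertState ε zm zp kx ς E := by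
  obtain ⟨hς, hord⟩ := h
  set T := scatteringOperator ε zm zp kx with hT
  have hcomp : IsCompactOperator (T ς) :=
    isCompactOperator_kernelOperator (memLp_scatteringKernel hε h1 hM hς zm zp)
  -- The Fredholm alternative for the compact operator at the nonzero value `1`.
  rcases hcomp.hasEigenvalue_or_mem_resolventSet (μ := 1) one_ne_zero with hev | hres
  · obtain ⟨E, hE⟩ := hev.exists_hasEigenvector
    exact ⟨E, hE.2, by simpa using hE.apply_eq_smul⟩
  · exfalso
    have hu : IsUnit (1 - T ς) := by
      have := spectrum.mem_resolventSet_iff.1 hres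
      rwa [map_one] at this
    have hcont : ContinuousAt (generalizedResolvent ε zm zp kx) ς := by
      obtain ⟨u, hu⟩ := hu
      have h3 := NormedRing.inverse_continuousAt u
      rw [hu] at h3
      have h4 : ContinuousAt T ς := tendsto_scatteringOperator hε h1 hM hς zm zp
      exact ContinuousAt.comp (g := Ring.inverse) (f := fun ς => 1 - T ς) h3 (h4.const_sub 1)
    -- A negative order makes the norm of the resolvent blow up on punctured neighbourhoods, which
    -- continuity at `ς` excludes.
    have h5 := tendsto_cobounded_of_meromorphicOrderAt_neg hord
    rw [← tendsto_norm_atTop_iff_cobounded] at h5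
    exact not_tendsto_atTop_of_tendsto_nhds (hcont.tendsto.mono_left nhdsWithin_le_nhds).norm h5

/-! ### The one-dimensional outgoing problem and its flux identity -/

theorem absolutelyContinuousOnInterval_of_dist_le {X Y : Type*} [PseudoMetricSpace X]
    [PseudoMetricSpace Y] {f : ℝ → X} {g : ℝ → Y} {a b C : ℝ} (hC : 0 ≤ C)
    (hg : AbsolutelyContinuousOnInterval g a b)
    (h : ∀ x ∈ Set.uIcc a b, ∀ y ∈ Set.uIcc a b, dist (f x) (f y) ≤ C * dist (g x) (g y)) :
    AbsolutelyContinuousOnInterval f a b := by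
  rw [absolutelyContinuousOnInterval_iff] at hg ⊢
  intro δ hδ
  -- Dividing by `C + 1` rather than `C` covers `C = 0`.
  obtain ⟨η, hη, h1⟩ := hg (δ / (C + 1)) (by positivity)
  refine ⟨η, hη, fun I hI hlen => ?_⟩
  have h2 := h1 I hI hlen
  rw [lt_div_iff₀ (by positivity)] at h2
  refine lt_of_le_of_lt ?_ h2
  rw [Finset.sum_mul]
  refine Finset.sum_le_sum fun i hi => ?_
  refine (h _ (hI.1 i hi).1 _ (hI.1 i hi).2).trans ?_
  rw [mul_comm]
  gcongr
  linarith

/-- The increments are dominated by those of the real-valued primitive of `‖f‖`, for which absolute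
continuity is known. -/
theorem absolutelyContinuousOnInterval_integral {E : Type*} [NormedAddCommGroup E]
    [NormedSpace ℝ E] {f : ℝ → E} {a b : ℝ}
    (hf : IntervalIntegrable f volume a b) :
    AbsolutelyContinuousOnInterval (fun x => ∫ t in a..x, f t) a b := by
  refine absolutelyContinuousOnInterval_of_dist_le zero_le_one
    (hf.norm.absolutelyContinuousOnInterval_intervalIntegral (c := a) (by simp)) ?_
  intro x hx y hy
  have i1 : IntervalIntegrable f volume a x := hf.mono_set (Set.uIcc_subset_uIcc_left hx)
  have i2 : IntervalIntegrable f volume a y := hf.mono_set (Set.uIcc_subset_uIcc_left hy)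
  rw [dist_eq_norm, dist_eq_norm, intervalIntegral.integral_interval_sub_left i1 i2,
    intervalIntegral.integral_interval_sub_left i1.norm i2.norm, one_mul, Real.norm_eq_abs]
  exact intervalIntegral.norm_integral_le_abs_integral_norm

theorem absolutelyContinuousOnInterval_re {f : ℝ → ℂ} {a b : ℝ}
    (hf : AbsolutelyContinuousOnInterval f a b) :
    AbsolutelyContinuousOnInterval (fun x => (f x).re) a b := by
  refine absolutelyContinuousOnInterval_of_dist_le zero_le_one hf fun x _ y _ => ?_
  rw [one_mul, Complex.dist_eq, Real.dist_eq, ← Complex.sub_re]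
  exact Complex.abs_re_le_norm _

theorem absolutelyContinuousOnInterval_im {f : ℝ → ℂ} {a b : ℝ}
    (hf : AbsolutelyContinuousOnInterval f a b) :
    AbsolutelyContinuousOnInterval (fun x => (f x).im) a b := by
  refine absolutelyContinuousOnInterval_of_dist_le zero_le_one hf fun x _ y _ => ?_
  rw [one_mul, Complex.dist_eq, Real.dist_eq, ← Complex.sub_im]
  exact Complex.abs_im_le_norm _

theorem hasDerivAt_cexp_mul_ofReal (κ : ℂ) (x : ℝ) :
    HasDerivAt (fun z : ℝ => Complex.exp (κ * z)) (κ * Complex.exp (κ * x)) x := by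
  have h := ((hasDerivAt_id (x : ℂ)).const_mul κ).cexp.comp_ofReal
  simp only [id, mul_one] at h
  rwa [mul_comm κ (Complex.exp _)]

theorem absolutelyContinuousOnInterval_cexp_mul (κ : ℂ) {f : ℝ → ℂ} {a b : ℝ}
    (hf : AbsolutelyContinuousOnInterval f a b) :
    AbsolutelyContinuousOnInterval (fun z : ℝ => Complex.exp (κ * z) * f z) a b := by
  have h : ContDiff ℝ 1 (fun z : ℝ => Complex.exp (κ * z)) :=
    (contDiff_const.mul Complex.ofRealCLM.contDiff).cexp
  exact (h.contDiffOn.absolutelyContinuousOnInterval).fun_smul hf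

/-- The outgoing solution `u` of `u'' + q² u = 2icq f` on `[a,b]`. -/
noncomputable def outgoingWave (q c : ℂ) (a b : ℝ) (f : ℝ → ℂ) (z : ℝ) : ℂ :=
  c * ∫ t in a..b, Complex.exp (Complex.I * q * |z - t|) * f t

/-- Cutting the integral at `t = z` removes the absolute value and factors the exponential. This
leaves an upward and a downward wave whose coefficients depend on `z` only through the limits of
integration, hence are absolutely continuous. -/
theorem outgoingWave_eq {a b : ℝ} {f : ℝ → ℂ} (hf : IntervalIntegrable f volume a b) (q c : ℂ)
    {z : ℝ} (hz : z ∈ Set.Icc a b) :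
    outgoingWave q c a b f z =
      c * (Complex.exp (Complex.I * q * z) *
          (∫ t in a..z, Complex.exp (-(Complex.I * q) * t) * f t) +
        Complex.exp (-(Complex.I * q) * z) *
          ((∫ t in a..b, Complex.exp (Complex.I * q * t) * f t) -
            ∫ t in a..z, Complex.exp (Complex.I * q * t) * f t)) := by
  have hab : a ≤ b := hz.1.trans hz.2
  have hzu : z ∈ Set.uIcc a b := by rwa [Set.uIcc_of_le hab]
  have i1 : IntervalIntegrable f volume a z := hf.mono_set (Set.uIcc_subset_uIcc_left hzu)
  have i2 : IntervalIntegrable f volume z b := hf.mono_set (Set.uIcc_subset_uIcc_right hzu)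
  have ic : ∀ {x y : ℝ} (κ : ℂ), IntervalIntegrable f volume x y →
      IntervalIntegrable (fun t : ℝ => Complex.exp (κ * t) * f t) volume x y := fun κ h =>
    h.continuousOn_mul (Continuous.continuousOn (by fun_prop))
  have ia : ∀ {x y : ℝ}, IntervalIntegrable f volume x y →
      IntervalIntegrable (fun t : ℝ => Complex.exp (Complex.I * q * |z - t|) * f t) volume x y :=
    fun h => h.continuousOn_mul (Continuous.continuousOn (by fun_prop))
  rw [outgoingWave, intervalIntegral.integral_interval_sub_left (ic _ hf) (ic _ i1),
    ← intervalIntegral.integral_add_adjacent_intervals (ia i1) (ia i2),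
    ← intervalIntegral.integral_const_mul, ← intervalIntegral.integral_const_mul]
  congr 2
  · refine intervalIntegral.integral_congr fun t ht => ?_
    rw [Set.uIcc_of_le hz.1] at ht
    rw [abs_of_nonneg (by linarith [ht.2]), ← mul_assoc, ← Complex.exp_add]
    congr 2
    push_cast
    ring
  · refine intervalIntegral.integral_congr fun t ht => ?_
    rw [Set.uIcc_of_le hz.2] at ht
    rw [abs_of_nonpos (by linarith [ht.1]), ← mul_assoc, ← Complex.exp_add]
    congr 2
    push_cast
    ring

/-- Integration of the derivative of `Im(ū u')`. Since `f` is merely integrable, `u'` is only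
absolutely continuous and its derivative exists almost everywhere, so the fundamental theorem of
calculus is used in its absolutely continuous form. -/
theorem outgoingWave_flux {a b : ℝ} (hab : a ≤ b) {f : ℝ → ℂ}
    (hf : IntervalIntegrable f volume a b) (q c : ℂ) :
    q.re * (‖outgoingWave q c a b f b‖ ^ 2 + ‖outgoingWave q c a b f a‖ ^ 2) =
      ∫ z in a..b, (-(q ^ 2).im * ‖outgoingWave q c a b f z‖ ^ 2 +
        (2 * c * Complex.I * q * (starRingEnd ℂ (outgoingWave q c a b f z) * f z)).im) := by
  set κ : ℂ := Complex.I * q with hκ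
  have ic : ∀ κ : ℂ,
      IntervalIntegrable (fun t : ℝ => Complex.exp (κ * t) * f t) volume a b := fun κ =>
    hf.continuousOn_mul (Continuous.continuousOn (by fun_prop))
  set A : ℝ → ℂ := fun z => ∫ t in a..z, Complex.exp (-κ * t) * f t with hA
  set B : ℝ → ℂ := fun z => (∫ t in a..b, Complex.exp (κ * t) * f t) -
    ∫ t in a..z, Complex.exp (κ * t) * f t with hB
  set U : ℝ → ℂ := fun z => c * (Complex.exp (κ * z) * A z + Complex.exp (-κ * z) * B z) with hU
  -- `W` plays the role of `u'`: the terms from differentiating `A` and `B` cancel in `U'`, but add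
  -- up to the source `2cκf` in `W'`.
  set W : ℝ → ℂ := fun z => c * κ * (Complex.exp (κ * z) * A z - Complex.exp (-κ * z) * B z)
    with hW
  have hcon : ∀ k : ℂ, AbsolutelyContinuousOnInterval (fun _ : ℝ => k) a b := fun k =>
    (contDiff_const (c := k) (n := 1)).contDiffOn.absolutelyContinuousOnInterval
  have acA : AbsolutelyContinuousOnInterval A a b := absolutelyContinuousOnInterval_integral (ic _)
  have acB : AbsolutelyContinuousOnInterval B a b :=
    (hcon _).fun_sub (absolutelyContinuousOnInterval_integral (ic _))
  have acU : AbsolutelyContinuousOnInterval U a b :=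
    (hcon c).fun_smul ((absolutelyContinuousOnInterval_cexp_mul κ acA).fun_add
      (absolutelyContinuousOnInterval_cexp_mul (-κ) acB))
  have acW : AbsolutelyContinuousOnInterval W a b :=
    (hcon (c * κ)).fun_smul ((absolutelyContinuousOnInterval_cexp_mul κ acA).fun_sub
      (absolutelyContinuousOnInterval_cexp_mul (-κ) acB))
  -- This is `Im(Ū W)` in real coordinates.
  set Φ : ℝ → ℝ := fun z => (U z).re * (W z).im - (U z).im * (W z).re with hΦ
  have acΦ : AbsolutelyContinuousOnInterval Φ a b :=
    ((absolutelyContinuousOnInterval_re acU).fun_mul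
      (absolutelyContinuousOnInterval_im acW)).fun_sub
      ((absolutelyContinuousOnInterval_im acU).fun_mul (absolutelyContinuousOnInterval_re acW))
  have hUeq : ∀ z ∈ Set.Icc a b, outgoingWave q c a b f z = U z := fun z hz =>
    outgoingWave_eq hf q c hz
  have hderiv : ∀ᵐ z : ℝ, z ∈ Set.uIoc a b → -(q ^ 2).im * ‖outgoingWave q c a b f z‖ ^ 2 +
        (2 * c * Complex.I * q * (starRingEnd ℂ (outgoingWave q c a b f z) * f z)).im
        = deriv Φ z := by
    filter_upwards [(ic (-κ)).ae_hasDerivAt_integral, (ic κ).ae_hasDerivAt_integral]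
      with z hz1 hz2 hz
    have hzu := Set.uIoc_subset_uIcc hz
    have hz' : z ∈ Set.Icc a b := by rwa [Set.uIcc_of_le hab] at hzu
    have dA : HasDerivAt A (Complex.exp (-κ * z) * f z) z := hz1 hzu a (by simp)
    have dB : HasDerivAt B (-(Complex.exp (κ * z) * f z)) z := (hz2 hzu a (by simp)).const_sub _
    have d1 := (hasDerivAt_cexp_mul_ofReal κ z).mul dA
    have d2 := (hasDerivAt_cexp_mul_ofReal (-κ) z).mul dB
    have he : Complex.exp (κ * z) * Complex.exp (-κ * z) = 1 := by
      rw [← Complex.exp_add]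
      simp
    have dU : HasDerivAt U (W z) z := by
      refine ((d1.add d2).const_mul c).congr_deriv ?_
      simp only [hW]
      ring
    have dW : HasDerivAt W (κ ^ 2 * U z + 2 * c * κ * f z) z := by
      refine ((d1.sub d2).const_mul (c * κ)).congr_deriv ?_
      simp only [hU]
      linear_combination (2 * c * κ * f z) * he
    have dUre : HasDerivAt (fun z => (U z).re) (W z).re z :=
      (Complex.reCLM.hasFDerivAt.comp_hasDerivAt z dU)
    have dUim : HasDerivAt (fun z => (U z).im) (W z).im z :=
      (Complex.imCLM.hasFDerivAt.comp_hasDerivAt z dU)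
    have dWre : HasDerivAt (fun z => (W z).re) (κ ^ 2 * U z + 2 * c * κ * f z).re z :=
      (Complex.reCLM.hasFDerivAt.comp_hasDerivAt z dW)
    have dWim : HasDerivAt (fun z => (W z).im) (κ ^ 2 * U z + 2 * c * κ * f z).im z :=
      (Complex.imCLM.hasFDerivAt.comp_hasDerivAt z dW)
    have dΦ := (dUre.mul dWim).sub (dUim.mul dWre)
    rw [hUeq z hz']
    refine Eq.trans ?_ dΦ.deriv.symm
    have hk2 : κ ^ 2 = -q ^ 2 := by
      rw [hκ, mul_pow, Complex.I_sq]
      ring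
    have hck : 2 * c * κ = 2 * c * Complex.I * q := by rw [hκ]; ring
    rw [hk2, hck, ← Complex.normSq_eq_norm_sq, Complex.normSq_apply]
    generalize 2 * c * Complex.I * q = β
    generalize q ^ 2 = γ
    simp only [Complex.mul_re, Complex.mul_im, Complex.add_re, Complex.add_im, Complex.neg_re,
      Complex.neg_im, Complex.conj_re, Complex.conj_im]
    ring
  rw [intervalIntegral.integral_congr_ae hderiv, acΦ.integral_deriv_eq_sub,
    hUeq b (Set.right_mem_Icc.2 hab), hUeq a (Set.left_mem_Icc.2 hab)]
  -- At `b` the downward coefficient `B` vanishes, and at `a` the upward coefficient `A` does: these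
  -- are the radiation conditions `u' = ± i q u`.
  have hWb : W b = κ * U b := by
    simp only [hW, hU, hB, sub_self]
    ring
  have hWa : W a = -κ * U a := by
    simp only [hW, hU, hA, intervalIntegral.integral_same]
    ring
  simp only [hΦ, hWb, hWa, ← Complex.normSq_eq_norm_sq, Complex.normSq_apply, hκ]
  simp only [Complex.mul_re, Complex.mul_im, Complex.neg_re, Complex.neg_im, Complex.I_re,
    Complex.I_im]
  ring

theorem norm_outgoingWave_right {a b : ℝ} (hab : a ≤ b) {f : ℝ → ℂ}
    (hf : IntervalIntegrable f volume a b) (q c : ℂ) :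
    ‖outgoingWave q c a b f b‖ ^ 2 =
      ‖c * ∫ t in a..b, Complex.exp (-(Complex.I * q) * t) * f t‖ ^ 2 *
        Real.exp (-2 * b * q.im) := by
  rw [outgoingWave_eq hf q c (Set.right_mem_Icc.2 hab), sub_self, mul_zero, add_zero,
    mul_left_comm, norm_mul, mul_pow, Complex.norm_exp, ← Real.exp_nat_mul, mul_comm]
  congr 2
  simp
  ring

theorem norm_outgoingWave_left {a b : ℝ} (hab : a ≤ b) {f : ℝ → ℂ}
    (hf : IntervalIntegrable f volume a b) (q c : ℂ) :
    ‖outgoingWave q c a b f a‖ ^ 2 =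
      ‖c * ∫ t in a..b, Complex.exp (Complex.I * q * t) * f t‖ ^ 2 *
        Real.exp (2 * a * q.im) := by
  rw [outgoingWave_eq hf q c (Set.left_mem_Icc.2 hab), intervalIntegral.integral_same, mul_zero,
    zero_add, intervalIntegral.integral_same, sub_zero, mul_left_comm, norm_mul, mul_pow, Complex.norm_exp, ← Real.exp_nat_mul,
    mul_comm]
  congr 2
  simp
  ring

/-! ### Fourier series in `x` and the reduction to single channels -/

/-- The coefficient `∫₀¹ G(x,z) exp (-i x k_{x,n}) dx` of `G(·,z)`. -/
noncomputable def xCoeff (kx : ℝ) (n : ℤ) (G : ℝ × ℝ → ℂ) (z : ℝ) : ℂ :=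
  ∫ x in Set.Icc (0 : ℝ) 1, Complex.exp (-(Complex.I * (x * xWaveNumber kx n))) * G (x, z)

/-- These are the ordinary Fourier coefficients of `exp(-i x k_x) G(x, z)`; the unimodular factor
leaves the `L²` norm unchanged, so Parseval on `[0,1]` applies. -/
theorem hasSum_sq_xCoeff (kx : ℝ) {G : ℝ × ℝ → ℂ} {z : ℝ}
    (hG : MemLp (fun x => G (x, z)) 2 (volume.restrict (Set.Icc (0 : ℝ) 1))) :
    HasSum (fun n => ‖xCoeff kx n G z‖ ^ 2) (∫ x in Set.Icc (0 : ℝ) 1, ‖G (x, z)‖ ^ 2) := by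
  have hnorm : ∀ x : ℝ, ‖Complex.exp (-(Complex.I * (x * kx)))‖ = 1 := by
    intro x
    rw [Complex.norm_exp]
    simp
  have hf : MemLp (fun x : ℝ => Complex.exp (-(Complex.I * (x * kx))) * G (x, z)) 2
      (volume.restrict (Set.Ioc (0 : ℝ) 1)) := by
    rw [Measure.restrict_congr_set (Ioc_ae_eq_Icc (μ := volume) (a := (0 : ℝ)) (b := 1))]
    refine hG.of_le ?_ ?_
    · exact (Continuous.aestronglyMeasurable (by fun_prop)).mul hG.1
    · refine .of_forall fun x => ?_
      rw [norm_mul, hnorm, one_mul]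
  have h := hasSum_sq_fourierCoeffOn zero_lt_one hf
  convert h using 1
  · funext n
    rw [fourierCoeffOn_eq_integral, xCoeff, integral_Icc_eq_integral_Ioc,
      ← intervalIntegral.integral_of_le zero_le_one]
    simp only [sub_zero, div_one, one_smul]
    congr 2
    refine intervalIntegral.integral_congr fun x _ => ?_
    rw [fourier_coe_apply, smul_eq_mul, ← mul_assoc (Complex.exp _) (Complex.exp _),
      ← Complex.exp_add]
    congr 2
    simp only [xWaveNumber]
    push_cast
    ring
  · rw [integral_Icc_eq_integral_Ioc, ← intervalIntegral.integral_of_le zero_le_one]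
    simp [hnorm]

theorem aestronglyMeasurable_xCoeff (kx : ℝ) (n : ℤ) {G : ℝ × ℝ → ℂ} {a b : ℝ}
    (hG : AEStronglyMeasurable G (volume.restrict (cell a b))) :
    AEStronglyMeasurable (xCoeff kx n G) (volume.restrict (Set.Icc a b)) := by
  rw [restrict_cell] at hG
  have h1 : AEStronglyMeasurable
      (fun p : ℝ × ℝ => Complex.exp (-(Complex.I * (p.1 * xWaveNumber kx n))) * G p)
      ((volume.restrict (Set.Icc (0 : ℝ) 1)).prod (volume.restrict (Set.Icc a b))) :=
    (Continuous.aestronglyMeasurable (by fun_prop)).mul hG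
  exact h1.prod_swap.integral_prod_right'

/-- Parseval's identity in the variable `x`, integrated over `z`. -/
theorem parseval_cell (kx : ℝ) {G : ℝ × ℝ → ℂ} {a b : ℝ}
    (hG : MemLp G 2 (volume.restrict (cell a b))) :
    (∀ n, MemLp (xCoeff kx n G) 2 (volume.restrict (Set.Icc a b))) ∧
      HasSum (fun n => ∫ z in Set.Icc a b, ‖xCoeff kx n G z‖ ^ 2)
        (∫ r in cell a b, ‖G r‖ ^ 2) := by
  have hm := fun n => aestronglyMeasurable_xCoeff kx n hG.1
  rw [restrict_cell] at hG ⊢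
  have hsec : ∀ᵐ z ∂(volume.restrict (Set.Icc a b)),
      MemLp (fun x => G (x, z)) 2 (volume.restrict (Set.Icc (0 : ℝ) 1)) := by
    have h1 := hG.comp_measurePreserving
      (Measure.measurePreserving_swap (μ := volume.restrict (Set.Icc a b))
        (ν := volume.restrict (Set.Icc (0 : ℝ) 1)))
    exact ae_memLp_two_section h1
  have hsq : Integrable (fun r => ‖G r‖ ^ 2) ((volume.restrict (Set.Icc (0 : ℝ) 1)).prod
      (volume.restrict (Set.Icc a b))) := hG.integrable_norm_pow (by norm_num)
  have hs : ∀ᵐ z ∂(volume.restrict (Set.Icc a b)), HasSum (fun n => ‖xCoeff kx n G z‖ ^ 2)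
      (∫ x in Set.Icc (0 : ℝ) 1, ‖G (x, z)‖ ^ 2) := by
    filter_upwards [hsec] with z hz using hasSum_sq_xCoeff kx hz
  have hint : Integrable (fun z => ∫ x in Set.Icc (0 : ℝ) 1, ‖G (x, z)‖ ^ 2)
      (volume.restrict (Set.Icc a b)) := hsq.integral_prod_right
  constructor
  · intro n
    rw [memLp_two_iff_integrable_sq_norm (hm n)]
    refine hint.mono' ((hm n).norm.pow 2) ?_
    filter_upwards [hs] with z hz
    rw [Real.norm_of_nonneg (sq_nonneg _)]
    exact le_hasSum hz n fun _ _ => sq_nonneg _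
  · rw [integral_prod_symm _ hsq]
    -- The terms are nonnegative and serve as their own majorants; their sum is integrable in `z` by
    -- Fubini.
    refine hasSum_integral_of_dominated_convergence (fun n z => ‖xCoeff kx n G z‖ ^ 2) ?_ ?_ ?_ ?_ hs
    · exact fun n => (hm n).norm.pow 2
    · exact fun n => .of_forall fun z => by rw [Real.norm_of_nonneg (sq_nonneg _)]
    · filter_upwards [hs] with z hz using hz.summable
    · refine hint.congr ?_
      filter_upwards [hs] with z hz using hz.tsum_eq.symm

theorem integral_cexp_int_mul_two_pi (k : ℤ) :
    ∫ x in Set.Icc (0 : ℝ) 1, Complex.exp (2 * Real.pi * Complex.I * k * x) =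
      if k = 0 then 1 else 0 := by
  rw [integral_Icc_eq_integral_Ioc, ← intervalIntegral.integral_of_le zero_le_one]
  split_ifs with hk
  · simp [hk]
  · rw [integral_exp_mul_complex (by simp [hk])]
    have h := Complex.exp_int_mul_two_pi_mul_I k
    rw [show (2 * Real.pi * Complex.I * k * (1 : ℝ) : ℂ) = k * (2 * Real.pi * Complex.I) by
      push_cast; ring, h]
    simp

theorem hasSum_greenKernel {kx : ℝ} {ς : ℂ} (hς : ς ∈ cutPlane kx) {r : ℝ × ℝ} (hr : r.2 ≠ 0) :
    HasSum (fun m : ℤ => Complex.I * ς / 2 *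
      (Complex.exp (Complex.I * (r.1 * xWaveNumber kx m + |r.2| * zWaveNumber kx ς m))
      / zWaveNumber kx ς m)) (greenKernel kx ς r) := by
  obtain ⟨A, hA, hb⟩ := exists_channel_bound hς |r.2|
  refine HasSum.mul_left _ (Summable.hasSum ?_)
  refine Summable.of_norm_bounded (hA.mul_right (|r.2| ^ (-(1 / 4) : ℝ))) fun m => ?_
  exact (norm_channel_term kx ς r m).trans_le (hb m r.2 (abs_pos.2 hr) le_rfl)

/-- Orthogonality of `exp(2πi(m - n)x)` on `[0,1]` leaves only the `n`-th term. For fixed `t ≠ 0`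
the channel bound justifies termwise integration. -/
theorem integral_cexp_mul_greenKernel {kx : ℝ} {ς : ℂ} (hς : ς ∈ cutPlane kx) (n : ℤ) (x₀ : ℝ)
    {t : ℝ} (ht : t ≠ 0) :
    ∫ x in Set.Icc (0 : ℝ) 1, Complex.exp (-(Complex.I * (x * xWaveNumber kx n))) *
        greenKernel kx ς (x - x₀, t) =
      Complex.I * ς / (2 * zWaveNumber kx ς n) *
        (Complex.exp (Complex.I * zWaveNumber kx ς n * |t|) *
          Complex.exp (-(Complex.I * (x₀ * xWaveNumber kx n)))) := by
  obtain ⟨A, hA, hb⟩ := exists_channel_bound hς |t|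
  set q := zWaveNumber kx ς with hq
  set T : ℤ → ℝ → ℂ := fun m x => Complex.exp (-(Complex.I * (x * xWaveNumber kx n))) *
    (Complex.I * ς / 2 *
      (Complex.exp (Complex.I * ((x - x₀ : ℝ) * xWaveNumber kx m + |t| * q m)) / q m)) with hT
  have h1 : HasSum (fun m => ∫ x in Set.Icc (0 : ℝ) 1, T m x)
      (∫ x in Set.Icc (0 : ℝ) 1, Complex.exp (-(Complex.I * (x * xWaveNumber kx n))) *
        greenKernel kx ς (x - x₀, t)) := by
    refine hasSum_integral_of_dominated_convergence
      (fun m _ => ‖Complex.I * ς / 2‖ * (A m * |t| ^ (-(1 / 4) : ℝ))) ?_ ?_ ?_ ?_ ?_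
    · exact fun m => Continuous.aestronglyMeasurable (by fun_prop)
    · refine fun m => .of_forall fun x => ?_
      have h2 := (norm_channel_term kx ς (x - x₀, t) m).trans_le (hb m t (abs_pos.2 ht) le_rfl)
      have h3 : ‖Complex.exp (-(Complex.I * (x * xWaveNumber kx n)))‖ = 1 := by
        rw [Complex.norm_exp]
        simp
      rw [hT, norm_mul, h3, one_mul, norm_mul]
      gcongr
    · exact .of_forall fun _ => (hA.mul_right _).mul_left _
    · exact integrable_const _
    · exact .of_forall fun x => (hasSum_greenKernel (r := (x - x₀, t)) hς ht).mul_left _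
  have h2 : ∀ m, ∫ x in Set.Icc (0 : ℝ) 1, T m x = if m = n then
      Complex.I * ς / (2 * q n) * (Complex.exp (Complex.I * q n * |t|) *
          Complex.exp (-(Complex.I * (x₀ * xWaveNumber kx n)))) else 0 := by
    intro m
    have e : ∀ x : ℝ, T m x = Complex.I * ς / (2 * q m) * (Complex.exp (Complex.I * q m * |t|) *
          Complex.exp (-(Complex.I * (x₀ * xWaveNumber kx m)))) *
        Complex.exp (2 * Real.pi * Complex.I * (m - n : ℤ) * x) := by
      intro x
      have e1 : Complex.exp (-(Complex.I * (x * xWaveNumber kx n))) *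
          Complex.exp (Complex.I * ((x - x₀ : ℝ) * xWaveNumber kx m + |t| * q m)) =
          Complex.exp (Complex.I * q m * |t|) *
          Complex.exp (-(Complex.I * (x₀ * xWaveNumber kx m))) *
          Complex.exp (2 * Real.pi * Complex.I * (m - n : ℤ) * x) := by
        rw [← Complex.exp_add, ← Complex.exp_add, ← Complex.exp_add]
        congr 1
        simp only [xWaveNumber]
        push_cast
        ring
      simp only [hT]
      calc _ = Complex.I * ς / (2 * q m) * (Complex.exp (-(Complex.I * (x * xWaveNumber kx n))) *
          Complex.exp (Complex.I * ((x - x₀ : ℝ) * xWaveNumber kx m + |t| * q m))) := by ring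
        _ = _ := by rw [e1]; ring
    simp_rw [e]
    rw [integral_const_mul, integral_cexp_int_mul_two_pi]
    by_cases hmn : m = n
    · simp [hmn]
    · simp [hmn, sub_eq_zero]
  simp_rw [h2] at h1
  exact h1.unique (hasSum_ite_eq n _)

/-- The Fourier coefficients of the field radiated by a source `F` solve the one-dimensional
outgoing problem for the Fourier coefficients of `F`. -/
theorem xCoeff_greenIntegral {kx : ℝ} {ς : ℂ} (hς : ς ∈ cutPlane kx) {a b : ℝ}
    {F : ℝ × ℝ → ℂ} (hF : MemLp F 2 (volume.restrict (cell a b))) (n : ℤ) {z : ℝ}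
    (hz : z ∈ Set.Icc a b) :
    xCoeff kx n (fun r => ∫ r₀ in cell a b, greenKernel kx ς (r - r₀) * F r₀) z =
      outgoingWave (zWaveNumber kx ς n) (Complex.I * ς / (2 * zWaveNumber kx ς n)) a b
        (xCoeff kx n F) z := by
  set q := zWaveNumber kx ς n with hq
  set μ : Measure (ℝ × ℝ) := volume.restrict (cell a b) with hμ
  have hFi : Integrable F μ := hF.integrable (by norm_num)
  have hae : ∀ᵐ r₀ ∂μ, z ≠ r₀.2 ∧ r₀ ∈ cell a b := by
    filter_upwards [ae_restrict_of_ae (s := cell a b) (ae_snd_ne z),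
      ae_restrict_mem (measurableSet_cell a b)] with r₀ h1 h2 using ⟨h1, h2⟩
  -- Joint integrability for Fubini: at fixed `z` the singularity `|z - z₀|^(-1/4)` is square
  -- integrable in `r₀`, and so is the source `F`.
  have hint : Integrable (fun p : ℝ × (ℝ × ℝ) =>
      Complex.exp (-(Complex.I * (p.1 * xWaveNumber kx n))) *
        (greenKernel kx ς ((p.1, z) - p.2) * F p.2))
      ((volume.restrict (Set.Icc (0 : ℝ) 1)).prod μ) := by
    obtain ⟨C, hC, hb⟩ := exists_greenKernel_bound hς |b - a|
    have hdom : Integrable (fun r₀ : ℝ × ℝ => C * (|z - r₀.2| ^ (-(1 / 4) : ℝ) * ‖F r₀‖)) μ :=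
      ((memLp_abs_sub_rpow hz).integrable_mul hF.norm).const_mul C
    refine (hdom.comp_snd (volume.restrict (Set.Icc (0 : ℝ) 1))).mono' ?_ ?_
    · refine (Continuous.aestronglyMeasurable (by fun_prop)).mul
        (AEStronglyMeasurable.mul ?_ hF.1.comp_snd)
      have := measurable_greenKernel kx ς
      exact Measurable.aestronglyMeasurable (by fun_prop)
    · filter_upwards [Measure.quasiMeasurePreserving_snd.ae hae] with p ⟨hp1, hp2⟩
      have h3 : ‖Complex.exp (-(Complex.I * (p.1 * xWaveNumber kx n)))‖ = 1 := by
        rw [Complex.norm_exp]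
        simp
      have h4 := hb ((p.1, z) - p.2) (abs_pos.2 (sub_ne_zero.2 hp1)) (by
        have := hp2.2
        rw [Set.mem_Icc] at *
        rw [abs_of_nonneg (by linarith : 0 ≤ b - a), Prod.snd_sub, abs_le]
        constructor <;> linarith)
      rw [norm_mul, h3, one_mul, norm_mul, ← mul_assoc]
      gcongr
      exact h4
  have hswap := integral_integral_swap (f := fun (x : ℝ) (r₀ : ℝ × ℝ) =>
    Complex.exp (-(Complex.I * (x * xWaveNumber kx n))) *
      (greenKernel kx ς ((x, z) - r₀) * F r₀)) hint
  have h1 : xCoeff kx n (fun r => ∫ r₀ in cell a b, greenKernel kx ς (r - r₀) * F r₀) z =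
      ∫ r₀, Complex.I * ς / (2 * q) * (Complex.exp (Complex.I * q * |z - r₀.2|) *
        (Complex.exp (-(Complex.I * (r₀.1 * xWaveNumber kx n))) * F r₀)) ∂μ := by
    rw [xCoeff]
    simp_rw [← integral_const_mul]
    rw [hswap]
    refine integral_congr_ae ?_
    filter_upwards [hae] with r₀ hr
    simp_rw [← mul_assoc]
    rw [integral_mul_const]
    congr 1
    have h2 := integral_cexp_mul_greenKernel hς n r₀.1 (sub_ne_zero.2 hr.1)
    simp only [← mul_assoc] at h2 ⊢
    exact h2
  have hcell : IsCompact (cell a b) := isCompact_Icc.prod isCompact_Icc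
  have hint2 : Integrable (fun r₀ : ℝ × ℝ => Complex.exp (Complex.I * q * |z - r₀.2|) *
        (Complex.exp (-(Complex.I * (r₀.1 * xWaveNumber kx n))) * F r₀)) μ := by
    have h3 : IntegrableOn F (cell a b) := hFi
    have h4 := (h3.continuousOn_mul (g := fun r₀ : ℝ × ℝ =>
      Complex.exp (-(Complex.I * (r₀.1 * xWaveNumber kx n))))
      (Continuous.continuousOn (by fun_prop)) hcell)
    exact h4.continuousOn_mul (Continuous.continuousOn (by fun_prop)) hcell
  rw [h1, integral_const_mul, outgoingWave, intervalIntegral.integral_of_le (hz.1.trans hz.2),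
    ← integral_Icc_eq_integral_Ioc]
  congr 1
  rw [hμ, restrict_cell] at hint2 ⊢
  rw [integral_prod_symm _ hint2]
  refine integral_congr_ae (.of_forall fun t => ?_)
  simp only [xCoeff]
  rw [integral_const_mul]

/-! ### The Siegert field and its amplitudes on larger rectangles -/

theorem cell_subset {a b zm zp : ℝ} (ha : a ≤ zm) (hb : zp ≤ b) : cell zm zp ⊆ cell a b :=
  Set.prod_mono subset_rfl (Set.Icc_subset_Icc ha hb)

theorem siegertField_ae_eq {ε : ℝ × ℝ → ℝ} (hε : Measurable ε) {M : ℝ} (h1 : ∀ r, 1 ≤ ε r)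
    (hM : ∀ r, ε r ≤ M) {zm zp kx : ℝ} {ς : ℂ} (hς : ς ∈ cutPlane kx)
    {E : Lp ℂ 2 (volume.restrict (cell zm zp))} (hE : IsSiegertState ε zm zp kx ς E) :
    siegertField ε zm zp kx ς E =ᵐ[volume.restrict (cell zm zp)] E := by
  have h := scatteringOperator_apply hε h1 hM hς zm zp E
  rw [hE.2] at h
  exact h.symm

/-- Extending `E` by zero to the larger rectangle exhibits the field as the image of an `L²`
function under the Hilbert–Schmidt kernel there. -/
theorem memLp_siegertField {ε : ℝ × ℝ → ℝ} (hε : Measurable ε) {M : ℝ} (h1 : ∀ r, 1 ≤ ε r)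
    (hM : ∀ r, ε r ≤ M) {zm zp kx : ℝ} {ς : ℂ} (hς : ς ∈ cutPlane kx)
    (E : Lp ℂ 2 (volume.restrict (cell zm zp))) {a b : ℝ} (ha : a ≤ zm) (hb : zp ≤ b) :
    MemLp (siegertField ε zm zp kx ς E) 2 (volume.restrict (cell a b)) := by
  have hD := measurableSet_cell zm zp
  have hsub := cell_subset ha hb
  have hind : MemLp ((cell zm zp).indicator E) 2 (volume.restrict (cell a b)) := by
    rw [memLp_indicator_iff_restrict hD, Measure.restrict_restrict hD,
      Set.inter_eq_left.2 hsub]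
    exact Lp.memLp E
  set f : Lp ℂ 2 (volume.restrict (cell a b)) := hind.toLp with hf
  have h := (memLp_kernel_apply (memLp_scatteringKernel hε h1 hM hς a b) f).2.1
  refine h.ae_eq (.of_forall fun r => ?_)
  have e : ∫ r₀ in cell a b, scatteringKernel ε kx ς (r, r₀) * f r₀ =
      ∫ r₀ in cell a b, (cell zm zp).indicator
        (fun r₀ => scatteringKernel ε kx ς (r, r₀) * E r₀) r₀ := by
    refine integral_congr_ae ?_
    filter_upwards [hind.coeFn_toLp] with r₀ hr
    rw [hf, hr]
    by_cases hr0 : r₀ ∈ cell zm zp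
    · simp [hr0]
    · simp [hr0]
  rw [e, setIntegral_indicator hD, Set.inter_eq_right.2 hsub]
  rfl

/-- The contrast `ε - 1` vanishes in the rectangle outside `D`, so sources on `D` can be treated as
sources on any larger rectangle. -/
theorem setIntegral_contrast {ε : ℝ × ℝ → ℝ} {zm zp a b : ℝ} (ha : a ≤ zm) (hb : zp ≤ b)
    (hsupp : ∀ r ∈ cell a b, r ∉ cell zm zp → ε r = 1) {Ψ E : ℝ × ℝ → ℂ}
    (hΨ : Ψ =ᵐ[volume.restrict (cell zm zp)] E) (g : ℝ × ℝ → ℂ) :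
    ∫ r in cell a b, g r * (((ε r : ℂ) - 1) * Ψ r) =
      ∫ r in cell zm zp, g r * (((ε r : ℂ) - 1) * E r) := by
  rw [setIntegral_eq_of_subset_of_forall_sdiff_eq_zero (measurableSet_cell a b)
    (cell_subset ha hb)]
  · refine integral_congr_ae ?_
    filter_upwards [hΨ] with r hr
    rw [hr]
  · intro r hr
    rw [hsupp r hr.1 hr.2]
    simp

/-- Fubini, integrating in `x` first. For `σ = ± 1` the right side is the coefficient appearing in
`norm_outgoingWave_right` and `norm_outgoingWave_left`. -/
theorem scatteringAmplitude_eq {ε : ℝ × ℝ → ℝ} {zm zp a b : ℝ} (hab : a ≤ b) (ha : a ≤ zm)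
    (hb : zp ≤ b) (hsupp : ∀ r ∈ cell a b, r ∉ cell zm zp → ε r = 1) {kx : ℝ} {ς : ℂ}
    {E : Lp ℂ 2 (volume.restrict (cell zm zp))} {Ψ : ℝ × ℝ → ℂ}
    (hΨ : Ψ =ᵐ[volume.restrict (cell zm zp)] E)
    (hF : MemLp (fun r => ((ε r : ℂ) - 1) * Ψ r) 2 (volume.restrict (cell a b)))
    (σ : ℝ) (n : ℤ) :
    scatteringAmplitude σ ε zm zp kx ς E n =
      Complex.I * ς / (2 * zWaveNumber kx ς n) * ∫ t in a..b,
        Complex.exp (-(Complex.I * (σ * zWaveNumber kx ς n)) * t) *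
          xCoeff kx n (fun r => ((ε r : ℂ) - 1) * Ψ r) t := by
  set q := zWaveNumber kx ς n with hq
  have hcell : IsCompact (cell a b) := isCompact_Icc.prod isCompact_Icc
  have hFi : IntegrableOn (fun r => ((ε r : ℂ) - 1) * Ψ r) (cell a b) := hF.integrable (by norm_num)
  have hint : Integrable (fun r : ℝ × ℝ => Complex.exp (-(Complex.I * (σ * q)) * r.2) *
        (Complex.exp (-(Complex.I * (r.1 * xWaveNumber kx n))) * (((ε r : ℂ) - 1) * Ψ r)))
        (volume.restrict (cell a b)) := by
    have h4 := (hFi.continuousOn_mul (g := fun r₀ : ℝ × ℝ =>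
      Complex.exp (-(Complex.I * (r₀.1 * xWaveNumber kx n))))
      (Continuous.continuousOn (by fun_prop)) hcell)
    exact h4.continuousOn_mul (Continuous.continuousOn (by fun_prop)) hcell
  have h1 : ∫ r in cell a b, Complex.exp (-(Complex.I * (σ * q)) * r.2) *
        (Complex.exp (-(Complex.I * (r.1 * xWaveNumber kx n))) * (((ε r : ℂ) - 1) * Ψ r)) =
      ∫ t in a..b, Complex.exp (-(Complex.I * (σ * q)) * t) *
          xCoeff kx n (fun r => ((ε r : ℂ) - 1) * Ψ r) t := by
    rw [intervalIntegral.integral_of_le hab, ← integral_Icc_eq_integral_Ioc]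
    rw [restrict_cell] at hint ⊢
    rw [integral_prod_symm _ hint]
    refine integral_congr_ae (.of_forall fun t => ?_)
    simp only [xCoeff]
    rw [integral_const_mul]
  rw [← h1, scatteringAmplitude]
  congr 1
  simp_rw [← mul_assoc (Complex.exp _) (Complex.exp _)]
  rw [setIntegral_contrast ha hb hsupp hΨ]
  refine integral_congr_ae (.of_forall fun r => ?_)
  beta_reduce
  rw [← Complex.exp_add, mul_comm]
  congr 2
  ring

theorem siegertField_eq_greenIntegral {ε : ℝ × ℝ → ℝ} {zm zp a b : ℝ} (ha : a ≤ zm)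
    (hb : zp ≤ b) (hsupp : ∀ r ∈ cell a b, r ∉ cell zm zp → ε r = 1) {kx : ℝ} {ς : ℂ}
    {E : Lp ℂ 2 (volume.restrict (cell zm zp))}
    (hΨE : siegertField ε zm zp kx ς E =ᵐ[volume.restrict (cell zm zp)] E) :
    siegertField ε zm zp kx ς E = fun r => ∫ r₀ in cell a b,
      greenKernel kx ς (r - r₀) * (((ε r₀ : ℂ) - 1) * siegertField ε zm zp kx ς E r₀) := by
  funext r
  rw [setIntegral_contrast ha hb hsupp hΨE, siegertField]
  refine integral_congr_ae (.of_forall fun r₀ => ?_)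
  beta_reduce
  ring

theorem xCoeff_add_mul_ae (kx : ℝ) (n : ℤ) {F G : ℝ × ℝ → ℂ} {a b : ℝ}
    (hF : Integrable F (volume.restrict (cell a b)))
    (hG : Integrable G (volume.restrict (cell a b))) (c : ℂ) :
    ∀ᵐ z ∂(volume.restrict (Set.Icc a b)), xCoeff kx n (fun r => F r + c * G r) z =
      xCoeff kx n F z + c * xCoeff kx n G z := by
  rw [restrict_cell] at hF hG
  have hi : ∀ {H : ℝ → ℂ}, Integrable H (volume.restrict (Set.Icc (0 : ℝ) 1)) → Integrable
      (fun x : ℝ => Complex.exp (-(Complex.I * (x * xWaveNumber kx n))) * H x)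
      (volume.restrict (Set.Icc (0 : ℝ) 1)) := by
    intro H hH
    have h : IntegrableOn H (Set.Icc (0 : ℝ) 1) := hH
    exact h.continuousOn_mul (Continuous.continuousOn (by fun_prop)) isCompact_Icc
  filter_upwards [hF.prod_left_ae, hG.prod_left_ae] with z h1 h2
  simp only [xCoeff]
  rw [← integral_const_mul, ← integral_add (hi h1) ((hi h2).const_mul c)]
  refine integral_congr_ae (.of_forall fun x => ?_)
  beta_reduce
  ring

/-! ### Flux balance per channel and in total -/

/-- The flux balance of a single channel. -/
theorem channel_flux_balance {ε : ℝ × ℝ → ℝ} {zm zp a b : ℝ} (hz : zm < zp) (ha : a ≤ zm)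
    (hb : zp ≤ b) (hsupp : ∀ r ∈ cell a b, r ∉ cell zm zp → ε r = 1) {kx : ℝ} {ς : ℂ}
    (hς : ς ∈ cutPlane kx) {E : Lp ℂ 2 (volume.restrict (cell zm zp))}
    (hΨE : siegertField ε zm zp kx ς E =ᵐ[volume.restrict (cell zm zp)] E)
    (hΨ : MemLp (siegertField ε zm zp kx ς E) 2 (volume.restrict (cell a b)))
    (hF : MemLp (fun r => ((ε r : ℂ) - 1) * siegertField ε zm zp kx ς E r) 2
      (volume.restrict (cell a b))) (n : ℤ) :
    channelFlux ε zm zp kx ς E a b n =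
      (resonanceWidth ς - 1 / 2) *
        (∫ z in Set.Icc a b, ‖xCoeff kx n (siegertField ε zm zp kx ς E) z‖ ^ 2) +
      1 / 2 * (∫ z in Set.Icc a b, ‖xCoeff kx n (fun r => siegertField ε zm zp kx ς E r +
        Complex.I * ς * (((ε r : ℂ) - 1) * siegertField ε zm zp kx ς E r)) z‖ ^ 2) -
      ‖ς‖ ^ 2 / 2 * (∫ z in Set.Icc a b, ‖xCoeff kx n (fun r =>
        ((ε r : ℂ) - 1) * siegertField ε zm zp kx ς E r) z‖ ^ 2) := by
  have hab : a ≤ b := by linarith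
  set Ψ := siegertField ε zm zp kx ς E with hΨdef
  set F : ℝ × ℝ → ℂ := fun r => ((ε r : ℂ) - 1) * Ψ r with hFdef
  set q := zWaveNumber kx ς n with hq
  have hq0 : q ≠ 0 := zWaveNumber_ne_zero hς n
  set c := Complex.I * ς / (2 * q) with hc
  have hG : MemLp (fun r => Ψ r + Complex.I * ς * F r) 2 (volume.restrict (cell a b)) :=
    hΨ.add (hF.const_mul _)
  have iΨ := (parseval_cell kx hΨ).1 n
  have iF := (parseval_cell kx hF).1 n
  have iG := (parseval_cell kx hG).1 n
  set f := xCoeff kx n F with hf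
  have hfi : IntervalIntegrable f volume a b := by
    rw [intervalIntegrable_iff_integrableOn_Icc_of_le hab]
    exact iF.integrable (by norm_num)
  have hw : ∀ z ∈ Set.Icc a b, xCoeff kx n Ψ z = outgoingWave q c a b f z := by
    intro z hz
    rw [hΨdef, siegertField_eq_greenIntegral ha hb hsupp hΨE, ← hΨdef]
    exact xCoeff_greenIntegral hς hF n hz
  have hflux : channelFlux ε zm zp kx ς E a b n =
      q.re * (‖outgoingWave q c a b f b‖ ^ 2 + ‖outgoingWave q c a b f a‖ ^ 2) := by
    rw [norm_outgoingWave_right hab hfi, norm_outgoingWave_left hab hfi, channelFlux,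
      amplitudePlus, amplitudeMinus, scatteringAmplitude_eq hab ha hb hsupp hΨE hF,
      scatteringAmplitude_eq hab ha hb hsupp hΨE hF, ← hq,
      show -(Complex.I * (((1 : ℝ) : ℂ) * q)) = -(Complex.I * q) by push_cast; ring,
      show -(Complex.I * (((-1 : ℝ) : ℂ) * q)) = Complex.I * q by push_cast; ring]
  have hq2 : (q ^ 2).im = ς.im := by
    rw [hq, zWaveNumber, cutSqrt_sq, Complex.sub_im, Complex.ofReal_im, sub_zero]
  -- With this `c` the outgoing equation has the source `-ς f`.
  have hcq : 2 * c * Complex.I * q = -ς := by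
    rw [hc]
    field_simp
    linear_combination ς * Complex.I_sq
  have j1 := iΨ.integrable_norm_pow (p := 2) (by norm_num)
  have j2 := iG.integrable_norm_pow (p := 2) (by norm_num)
  have j3 := iF.integrable_norm_pow (p := 2) (by norm_num)
  have j12 : Integrable (fun z => (resonanceWidth ς - 1 / 2) * ‖xCoeff kx n Ψ z‖ ^ 2 +
      1 / 2 * ‖xCoeff kx n (fun r => Ψ r + Complex.I * ς * F r) z‖ ^ 2)
      (volume.restrict (Set.Icc a b)) := (j1.const_mul _).add (j2.const_mul _)
  rw [hflux, outgoingWave_flux hab hfi, intervalIntegral.integral_of_le hab,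
    ← integral_Icc_eq_integral_Ioc, ← integral_const_mul, ← integral_const_mul,
    ← integral_const_mul, ← integral_add (j1.const_mul _) (j2.const_mul _),
    ← integral_sub j12 (j3.const_mul _)]
  refine integral_congr_ae ?_
  filter_upwards [ae_restrict_mem measurableSet_Icc, xCoeff_add_mul_ae kx n
    (hΨ.integrable (by norm_num)) (hF.integrable (by norm_num)) (Complex.I * ς)] with z hz hadd
  -- Polarization: `-Im(ς ū f) = ½(|u + iςf|² - |u|² - |ς|²|f|²)`. The balance then contains only
  -- squared norms, to which Parseval applies directly.
  rw [hadd, ← hf, ← hw z hz, hq2, hcq, resonanceWidth]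
  simp only [← Complex.normSq_eq_norm_sq, Complex.normSq_apply, Complex.mul_re, Complex.mul_im,
    Complex.add_re, Complex.add_im, Complex.neg_re, Complex.neg_im, Complex.conj_re,
    Complex.conj_im, Complex.I_re, Complex.I_im]
  ring

/-- The flux through the lines `z = a` and `z = b`, summed over all channels. -/
theorem hasSum_channelFlux {ε : ℝ × ℝ → ℝ} {M : ℝ} (hε : Measurable ε) (h1 : ∀ r, 1 ≤ ε r)
    (hM : ∀ r, ε r ≤ M) {zm zp a b : ℝ} (hz : zm < zp) (ha : a ≤ zm)
    (hb : zp ≤ b) (hsupp : ∀ r ∈ cell a b, r ∉ cell zm zp → ε r = 1) {kx : ℝ} {ς : ℂ}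
    (hς : ς ∈ cutPlane kx) {E : Lp ℂ 2 (volume.restrict (cell zm zp))}
    (hE : IsSiegertState ε zm zp kx ς E) :
    IntegrableOn (fun r => ‖siegertField ε zm zp kx ς E r‖ ^ 2 * ε r) (cell a b) ∧
      HasSum (channelFlux ε zm zp kx ς E a b)
        (resonanceWidth ς * fieldEnergy ε zm zp kx ς E a b) := by
  have hΨE := siegertField_ae_eq hε h1 hM hς hE
  have hΨ := memLp_siegertField hε h1 hM hς E ha hb
  set Ψ := siegertField ε zm zp kx ς E with hΨdef
  have hF : MemLp (fun r => ((ε r : ℂ) - 1) * Ψ r) 2 (volume.restrict (cell a b)) := by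
    refine (hΨ.const_mul ((M - 1 : ℝ) : ℂ)).of_le ?_ (.of_forall fun r => ?_)
    · exact (Measurable.aestronglyMeasurable (by fun_prop)).mul hΨ.1
    · rw [norm_mul, norm_mul]
      gcongr
      refine (norm_contrast_le h1 hM r).trans ?_
      rw [Complex.norm_real]
      exact le_abs_self _
  have hG : MemLp (fun r => Ψ r + Complex.I * ς * (((ε r : ℂ) - 1) * Ψ r)) 2
      (volume.restrict (cell a b)) := hΨ.add (hF.const_mul _)
  have j1 := hΨ.integrable_norm_pow (p := 2) (by norm_num)
  have j2 := hG.integrable_norm_pow (p := 2) (by norm_num)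
  have j3 := hF.integrable_norm_pow (p := 2) (by norm_num)
  have hen : IntegrableOn (fun r => ‖Ψ r‖ ^ 2 * ε r) (cell a b) := by
    refine (j1.mul_const M).mono' (j1.1.mul hε.aestronglyMeasurable) (.of_forall fun r => ?_)
    rw [Real.norm_of_nonneg (mul_nonneg (sq_nonneg _) (by linarith [h1 r]))]
    exact mul_le_mul_of_nonneg_left (hM r) (sq_nonneg _)
  refine ⟨hen, ?_⟩
  have hsum := (((parseval_cell kx hΨ).2.mul_left (resonanceWidth ς - 1 / 2)).add
    ((parseval_cell kx hG).2.mul_left (1 / 2))).sub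
    ((parseval_cell kx hF).2.mul_left (‖ς‖ ^ 2 / 2))
  have j12 : Integrable (fun r => (resonanceWidth ς - 1 / 2) * ‖Ψ r‖ ^ 2 +
      1 / 2 * ‖Ψ r + Complex.I * ς * (((ε r : ℂ) - 1) * Ψ r)‖ ^ 2)
      (volume.restrict (cell a b)) := (j1.const_mul _).add (j2.const_mul _)
  -- The same polarization undone pointwise: with `F = (ε - 1)Ψ` real-proportional to `Ψ`, one gets
  -- `-Im(ς Ψ̄ F) = Γ(ε - 1)|Ψ|²`, which together with `Γ|Ψ|²` gives `Γ ε|Ψ|²`.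
  have htot : resonanceWidth ς * fieldEnergy ε zm zp kx ς E a b =
      (resonanceWidth ς - 1 / 2) * (∫ r in cell a b, ‖Ψ r‖ ^ 2) +
      1 / 2 * (∫ r in cell a b, ‖Ψ r + Complex.I * ς * (((ε r : ℂ) - 1) * Ψ r)‖ ^ 2) -
      ‖ς‖ ^ 2 / 2 * ∫ r in cell a b, ‖((ε r : ℂ) - 1) * Ψ r‖ ^ 2 := by
    unfold fieldEnergy
    rw [← integral_const_mul, ← integral_const_mul, ← integral_const_mul,
      ← integral_const_mul, ← integral_add (j1.const_mul _) (j2.const_mul _),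
      ← integral_sub j12 (j3.const_mul _)]
    refine integral_congr_ae (.of_forall fun r => ?_)
    simp only [← hΨdef, resonanceWidth, ← Complex.normSq_eq_norm_sq, Complex.normSq_apply,
      Complex.mul_re, Complex.mul_im, Complex.add_re, Complex.add_im, Complex.sub_re,
      Complex.sub_im, Complex.one_re, Complex.one_im, Complex.ofReal_re, Complex.ofReal_im,
      Complex.I_re, Complex.I_im]
    ring
  rw [htot, show channelFlux ε zm zp kx ς E a b = _ from
    funext fun n => channel_flux_balance hz ha hb hsupp hς hΨE hΨ hF n]
  exact hsum

/-! ### Plane-wave expansion outside the slab -/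

/-- Outside the slab the field is a superposition of outgoing plane waves. -/
theorem hasSum_outgoing {ε : ℝ × ℝ → ℝ} {M : ℝ} (hε : Measurable ε) (h1 : ∀ r, 1 ≤ ε r)
    (hM : ∀ r, ε r ≤ M) {zm zp kx : ℝ} {ς : ℂ} (hς : ς ∈ cutPlane kx)
    (E : Lp ℂ 2 (volume.restrict (cell zm zp))) (x : ℝ) {z σ : ℝ}
    (hz : ∀ t ∈ Set.Icc zm zp, |z - t| = σ * (z - t) ∧ z ≠ t) :
    HasSum (fun m : ℤ => scatteringAmplitude σ ε zm zp kx ς E m *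
        Complex.exp (Complex.I * (x * xWaveNumber kx m + σ * z * zWaveNumber kx ς m)))
      (siegertField ε zm zp kx ς E (x, z)) := by
  set q := zWaveNumber kx ς with hq
  -- The interval is enlarged to contain `z`, so that `b - a` bounds `|z - t|` and the square
  -- integrability of the singularity can be quoted at height `z`.
  set a := min z zm with ha
  set b := max z zp with hb
  obtain ⟨A, hA, hbd⟩ := exists_channel_bound hς |b - a|
  have hcell : ∀ᵐ r₀ ∂(volume.restrict (cell zm zp)), r₀ ∈ cell zm zp := ae_restrict_mem (measurableSet_cell zm zp)
  set T : ℤ → ℝ × ℝ → ℂ := fun m r₀ => ((ε r₀ : ℂ) - 1) * (Complex.I * ς / 2 *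
    (Complex.exp (Complex.I * ((x - r₀.1 : ℝ) * xWaveNumber kx m + |z - r₀.2| * q m)) / q m)) *
      E r₀ with hT
  have hsum : HasSum (fun m => ∫ r₀ in cell zm zp, T m r₀) (siegertField ε zm zp kx ς E (x, z)) := by
    refine hasSum_integral_of_dominated_convergence
      (fun m r₀ => A m * ((M - 1) * ‖Complex.I * ς / 2‖ *
        (|z - r₀.2| ^ (-(1 / 4) : ℝ) * ‖E r₀‖))) ?_ ?_ ?_ ?_ ?_
    · refine fun m => AEStronglyMeasurable.mul (Measurable.aestronglyMeasurable ?_)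
        (Lp.aestronglyMeasurable E)
      fun_prop
    · intro m
      filter_upwards [hcell] with r₀ hr
      have h2 := (norm_channel_term kx ς (x - r₀.1, z - r₀.2) m).trans_le
        (hbd m (z - r₀.2) (abs_pos.2 (sub_ne_zero.2 (hz _ hr.2).2)) (by
          have h3 := hr.2
          have e1 := min_le_left z zm
          have e2 := min_le_right z zm
          have e3 := le_max_left z zp
          have e4 := le_max_right z zp
          rw [Set.mem_Icc] at h3
          rw [abs_of_nonneg (by linarith : 0 ≤ b - a), abs_le]
          constructor <;> linarith))
      have h3 := norm_contrast_le h1 hM r₀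
      rw [hT, norm_mul, norm_mul, norm_mul]
      calc _ ≤ (M - 1) * (‖Complex.I * ς / 2‖ * (A m * |z - r₀.2| ^ (-(1 / 4) : ℝ))) * ‖E r₀‖ := by
            have : 0 ≤ M - 1 := (norm_nonneg _).trans h3
            gcongr
        _ = _ := by ring
    · exact .of_forall fun _ => hA.mul_right _
    · simp_rw [tsum_mul_right]
      refine (Integrable.const_mul ?_ _).const_mul _
      have hzab : z ∈ Set.Icc a b := ⟨min_le_left _ _, le_max_left _ _⟩
      have h4 := (memLp_abs_sub_rpow hzab).mono_measure (Measure.restrict_mono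
        (cell_subset (min_le_right z zm) (le_max_right z zp)) le_rfl)
      exact h4.integrable_mul (Lp.memLp E).norm
    · filter_upwards [hcell] with r₀ hr
      exact ((hasSum_greenKernel (r := (x, z) - r₀) hς
        (sub_ne_zero.2 (hz _ hr.2).2)).mul_left _).mul_right _
  suffices hc : (fun m : ℤ => scatteringAmplitude σ ε zm zp kx ς E m *
      Complex.exp (Complex.I * (x * xWaveNumber kx m + σ * z * q m))) =
      fun m => ∫ r₀ in cell zm zp, T m r₀ by
    rw [hc]
    exact hsum
  funext m
  rw [scatteringAmplitude, ← hq, ← integral_const_mul, ← integral_mul_const]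
  refine integral_congr_ae ?_
  filter_upwards [hcell] with r₀ hr
  -- Outside the slab `|z - z₀| = σ(z - z₀)`, so the phase splits into a source factor and a plane
  -- wave.
  have he : Complex.exp (Complex.I * (-(r₀.1 * xWaveNumber kx m) - σ * r₀.2 * q m)) *
      Complex.exp (Complex.I * (x * xWaveNumber kx m + σ * z * q m)) =
      Complex.exp (Complex.I * ((x - r₀.1 : ℝ) * xWaveNumber kx m + |z - r₀.2| * q m)) := by
    rw [← Complex.exp_add, (hz _ hr.2).1]
    congr 1
    push_cast
    ring
  have hq0 : q m ≠ 0 := zWaveNumber_ne_zero hς m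
  simp only [hT]
  rw [← he]
  field_simp

/-! ### Positivity of the energy and decay of closed channels -/

theorem fieldEnergy_pos {ε : ℝ × ℝ → ℝ} (h1 : ∀ r, 1 ≤ ε r) {zm zp kx : ℝ} {ς : ℂ}
    {E : Lp ℂ 2 (volume.restrict (cell zm zp))} (hE : E ≠ 0)
    (hΨE : siegertField ε zm zp kx ς E =ᵐ[volume.restrict (cell zm zp)] E)
    (hi : IntegrableOn (fun r => ‖siegertField ε zm zp kx ς E r‖ ^ 2 * ε r) (cell zm zp)) :
    0 < fieldEnergy ε zm zp kx ς E zm zp := by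
  have hnn : ∀ r, 0 ≤ ‖siegertField ε zm zp kx ς E r‖ ^ 2 * ε r := fun r =>
    mul_nonneg (sq_nonneg _) (by linarith [h1 r])
  refine lt_of_le_of_ne (integral_nonneg hnn) fun h => hE ?_
  rw [fieldEnergy, eq_comm, integral_eq_zero_iff_of_nonneg hnn hi] at h
  rw [Lp.eq_zero_iff_ae_eq_zero]
  filter_upwards [h, hΨE] with r h2 h3
  have h4 : ε r ≠ 0 := by linarith [h1 r]
  simpa [h4, h3] using h2

theorem fieldEnergy_mono {ε : ℝ × ℝ → ℝ} (h1 : ∀ r, 1 ≤ ε r) {zm zp kx : ℝ} {ς : ℂ}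
    {E : Lp ℂ 2 (volume.restrict (cell zm zp))} {a b : ℝ} (ha : a ≤ zm) (hb : zp ≤ b)
    (hi : IntegrableOn (fun r => ‖siegertField ε zm zp kx ς E r‖ ^ 2 * ε r) (cell a b)) :
    fieldEnergy ε zm zp kx ς E zm zp ≤ fieldEnergy ε zm zp kx ς E a b :=
  setIntegral_mono_set hi (.of_forall fun r => mul_nonneg (sq_nonneg _) (by linarith [h1 r]))
    (cell_subset ha hb).eventuallyLE

/-- For `Im w > 0` the number `-iw` lies in the right half plane, so the argument `(arg(-iw) +
π/2)/2` of the root lies in `[0, π/2]`. -/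
theorem cutSqrt_re_nonneg {w : ℂ} (hw : 0 < w.im) : 0 ≤ (cutSqrt w).re := by
  have h0 : w ≠ 0 := by
    rintro rfl
    simp at hw
  have hre : (-Complex.I * w).re = w.im := by simp
  have h1 := Complex.abs_arg_le_pi_div_two_iff.2 (show 0 ≤ (-Complex.I * w).re by linarith)
  rw [abs_le] at h1
  rw [cutSqrt, if_neg h0, Complex.exp_re]
  refine mul_nonneg (Real.exp_pos _).le ?_
  have h3 : (cutLog w / 2).im = ((-Complex.I * w).arg + Real.pi / 2) / 2 := by
    rw [cutLog, Complex.div_ofNat_im, Complex.add_im, Complex.log_im, Complex.im_ofReal_mul,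
      Complex.I_im, mul_one]
  rw [h3]
  exact Real.cos_nonneg_of_neg_pi_div_two_le_of_le (by linarith [Real.pi_pos]) (by linarith)

theorem zWaveNumber_im_pos {kx : ℝ} {ς : ℂ} {m : ℤ} (hm : m ∉ openChannels kx ς) :
    0 < (zWaveNumber kx ς m).im := by
  refine cutSqrt_im_pos ?_
  rw [Complex.sub_re, Complex.ofReal_re]
  by_contra! h
  exact hm ((finite_openChannels kx ς).mem_toFinset.2
    (show xWaveNumber kx m ^ 2 ≤ ς.re by linarith))

/-- The flux of the closed channels vanishes far away from the slab. -/
theorem tendsto_tsum_closedFlux {ε : ℝ × ℝ → ℝ} {zm zp kx : ℝ} {ς : ℂ}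
    {E : Lp ℂ 2 (volume.restrict (cell zm zp))}
    (hs : Summable (channelFlux ε zm zp kx ς E zm zp)) :
    Filter.Tendsto (fun p : ℝ × ℝ => ∑' m : ℤ, if m ∈ openChannels kx ς then 0 else
        channelFlux ε zm zp kx ς E p.1 p.2 m) (Filter.atBot ×ˢ Filter.atTop) (nhds 0) := by
  have h := tendsto_tsum_of_dominated_convergence (𝓕 := Filter.atBot ×ˢ Filter.atTop)
    (f := fun (p : ℝ × ℝ) (m : ℤ) => if m ∈ openChannels kx ς then 0 else
        channelFlux ε zm zp kx ς E p.1 p.2 m) (g := fun _ => 0) hs.norm ?_ ?_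
  · simpa using h
  · intro m
    by_cases hm : m ∈ openChannels kx ς
    · simp [hm]
    · simp only [hm, if_false]
      have hq := zWaveNumber_im_pos hm
      have e1 : Filter.Tendsto (fun p : ℝ × ℝ => Real.exp (-2 * p.2 * (zWaveNumber kx ς m).im))
          (Filter.atBot ×ˢ Filter.atTop) (nhds 0) := by
        refine Real.tendsto_exp_atBot.comp ?_
        exact ((Filter.tendsto_snd (f := Filter.atBot) (g := Filter.atTop)).const_mul_atTop_of_neg
          (by norm_num : (-2 : ℝ) < 0)).atBot_mul_const hq
      have e2 : Filter.Tendsto (fun p : ℝ × ℝ => Real.exp (2 * p.1 * (zWaveNumber kx ς m).im))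
          (Filter.atBot ×ˢ Filter.atTop) (nhds 0) := by
        refine Real.tendsto_exp_atBot.comp ?_
        exact ((Filter.tendsto_fst (f := Filter.atBot) (g := Filter.atTop)).const_mul_atBot
          (by norm_num : (0 : ℝ) < 2)).atBot_mul_const hq
      have e3 := ((e1.const_mul (‖amplitudePlus ε zm zp kx ς E m‖ ^ 2)).add
        (e2.const_mul (‖amplitudeMinus ε zm zp kx ς E m‖ ^ 2))).const_mul (zWaveNumber kx ς m).re
      simpa [channelFlux] using e3
  -- Since `Im q > 0`, both exponentials decrease as the rectangle grows, so each closed flux is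
  -- dominated by its value on `D`, where the series converges absolutely.
  · filter_upwards [(Filter.eventually_le_atBot zm).prod_mk (Filter.eventually_ge_atTop zp)]
      with p ⟨hp1, hp2⟩ m
    by_cases hm : m ∈ openChannels kx ς
    · simp [hm]
    · simp only [hm, if_false]
      have hq := zWaveNumber_im_pos hm
      have hn : ∀ a b : ℝ, ‖channelFlux ε zm zp kx ς E a b m‖ = ‖(zWaveNumber kx ς m).re‖ *
          (‖amplitudePlus ε zm zp kx ς E m‖ ^ 2 * Real.exp (-2 * b * (zWaveNumber kx ς m).im) +
          ‖amplitudeMinus ε zm zp kx ς E m‖ ^ 2 * Real.exp (2 * a * (zWaveNumber kx ς m).im)) := by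
        intro a b
        rw [channelFlux, norm_mul, Real.norm_of_nonneg (r := _ + _) (by positivity)]
      rw [hn, hn]
      have e1 : -2 * p.2 * (zWaveNumber kx ς m).im ≤ -2 * zp * (zWaveNumber kx ς m).im := by
        nlinarith
      gcongr

end PeriodicScattering

/-! ### Assembly -/

theorem mainTheorem3
    (ε : ℝ × ℝ → ℝ) (hε_meas : Measurable ε) (hε_ge : ∀ r, 1 ≤ ε r)
    (hε_bdd : ∃ M : ℝ, ∀ r, ε r ≤ M) (hε_per : ∀ x z : ℝ, ε (x + 1, z) = ε (x, z))
    (zm zp : ℝ) (hz : zm < zp)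
    (hε_supp : ∀ x ∈ Set.Icc (0 : ℝ) 1, ∀ z : ℝ, ε (x, z) ≠ 1 → z ∈ Set.Icc zm zp)
    (kx : ℝ) :
    (∀ ς : ℂ, IsResonancePole ε zm zp kx ς →
      0 ≤ resonanceWidth ς ∧
      ∃ E : Lp ℂ 2 (volume.restrict (cell zm zp)), IsSiegertState ε zm zp kx ς E) ∧
    (∀ ς ∈ cutPlane kx, ∀ E : Lp ℂ 2 (volume.restrict (cell zm zp)),
      IsSiegertState ε zm zp kx ς E →
      siegertField ε zm zp kx ς E =ᵐ[volume.restrict (cell zm zp)] E ∧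
      (∀ x z : ℝ, z < zm →
        HasSum (fun m : ℤ => amplitudeMinus ε zm zp kx ς E m *
            Complex.exp (Complex.I * (x * xWaveNumber kx m - z * zWaveNumber kx ς m)))
          (siegertField ε zm zp kx ς E (x, z))) ∧
      (∀ x z : ℝ, zp < z →
        HasSum (fun m : ℤ => amplitudePlus ε zm zp kx ς E m *
            Complex.exp (Complex.I * (x * xWaveNumber kx m + z * zWaveNumber kx ς m)))
          (siegertField ε zm zp kx ς E (x, z))) ∧
      (∀ z₁ z₂ : ℝ, z₁ ≤ zm → zp ≤ z₂ →
        IntegrableOn (fun r => ‖siegertField ε zm zp kx ς E r‖ ^ 2 * ε r) (cell z₁ z₂) ∧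
        0 < fieldEnergy ε zm zp kx ς E z₁ z₂ ∧
        Summable (channelFlux ε zm zp kx ς E z₁ z₂) ∧
        resonanceWidth ς =
          (∑' m : ℤ, channelFlux ε zm zp kx ς E z₁ z₂ m) / fieldEnergy ε zm zp kx ς E z₁ z₂) ∧
      Filter.Tendsto
        (fun p : ℝ × ℝ => (∑ m ∈ openChannels kx ς, channelFlux ε zm zp kx ς E p.1 p.2 m) /
          fieldEnergy ε zm zp kx ς E p.1 p.2)
        (Filter.atBot ×ˢ Filter.atTop) (nhds (resonanceWidth ς))) := by
  obtain ⟨M, hM⟩ := hε_bdd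
  have hsupp : ∀ a b : ℝ, ∀ r ∈ cell a b, r ∉ cell zm zp → ε r = 1 := by
    intro a b r hr hr2
    by_contra h
    exact hr2 ⟨hr.1, hε_supp r.1 hr.1 r.2 h⟩
  have main : ∀ ς ∈ cutPlane kx, ∀ E : Lp ℂ 2 (volume.restrict (cell zm zp)),
      IsSiegertState ε zm zp kx ς E → ∀ z₁ z₂ : ℝ, z₁ ≤ zm → zp ≤ z₂ →
        IntegrableOn (fun r => ‖siegertField ε zm zp kx ς E r‖ ^ 2 * ε r) (cell z₁ z₂) ∧
        0 < fieldEnergy ε zm zp kx ς E z₁ z₂ ∧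
        Summable (channelFlux ε zm zp kx ς E z₁ z₂) ∧
        resonanceWidth ς =
          (∑' m : ℤ, channelFlux ε zm zp kx ς E z₁ z₂ m) / fieldEnergy ε zm zp kx ς E z₁ z₂ := by
    intro ς hς E hE z₁ z₂ h₁ h₂
    have hD := hasSum_channelFlux hε_meas hε_ge hM hz le_rfl le_rfl (hsupp zm zp) hς hE
    have hD' := hasSum_channelFlux hε_meas hε_ge hM hz h₁ h₂ (hsupp z₁ z₂) hς hE
    have hpos : 0 < fieldEnergy ε zm zp kx ς E z₁ z₂ :=
      (fieldEnergy_pos hε_ge hE.1 (siegertField_ae_eq hε_meas hε_ge hM hς hE) hD.1).trans_le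
        (fieldEnergy_mono hε_ge h₁ h₂ hD'.1)
    exact ⟨hD'.1, hpos, hD'.2.summable, by rw [hD'.2.tsum_eq, mul_div_cancel_right₀ _ hpos.ne']⟩
  refine ⟨fun ς hpole => ?_, fun ς hς E hE => ⟨?_, ?_, ?_, main ς hς E hE, ?_⟩⟩
  · obtain ⟨E, hE⟩ := exists_isSiegertState_of_isResonancePole hε_meas hε_ge hM hpole
    refine ⟨?_, E, hE⟩
    -- If `Γ < 0`, then every radicand has positive imaginary part, so all fluxes are nonnegative
    -- and the formula gives `Γ ≥ 0`.
    by_contra! hneg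
    have him : 0 < ς.im := by
      rw [resonanceWidth] at hneg
      linarith
    obtain ⟨-, hpos, -, heq⟩ := main ς hpole.1 E hE zm zp le_rfl le_rfl
    rw [heq] at hneg
    refine hneg.not_ge (div_nonneg (tsum_nonneg fun m => mul_nonneg ?_ (by positivity)) hpos.le)
    exact cutSqrt_re_nonneg (by simpa [-Complex.ofReal_pow] using him)
  · exact siegertField_ae_eq hε_meas hε_ge hM hς hE
  · intro x z hzz
    have h := hasSum_outgoing hε_meas hε_ge hM hς E x (z := z) (σ := -1) fun t ht =>
      ⟨by rw [abs_of_neg (by linarith [ht.1])]; ring, by linarith [ht.1]⟩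
    simpa [amplitudeMinus, ← sub_eq_add_neg] using h
  · intro x z hzz
    have h := hasSum_outgoing hε_meas hε_ge hM hς E x (z := z) (σ := 1) fun t ht =>
      ⟨by rw [abs_of_pos (by linarith [ht.2])]; ring, by linarith [ht.2]⟩
    simpa [amplitudePlus] using h
  · have hclosed := tendsto_tsum_closedFlux (main ς hς E hE zm zp le_rfl le_rfl).2.2.1
    obtain ⟨-, he0, -, -⟩ := main ς hς E hE zm zp le_rfl le_rfl
    have hev := (Filter.eventually_le_atBot zm).prod_mk (Filter.eventually_ge_atTop zp)
    -- The energies in the denominators are at least the fixed positive energy on `D`, so the closed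
    -- part of the quotient tends to zero.
    have hquot : Filter.Tendsto (fun p : ℝ × ℝ => (∑' m : ℤ, if m ∈ openChannels kx ς then 0 else
        channelFlux ε zm zp kx ς E p.1 p.2 m) / fieldEnergy ε zm zp kx ς E p.1 p.2)
        (Filter.atBot ×ˢ Filter.atTop) (nhds 0) := by
      have hb := hclosed.norm.div_const (fieldEnergy ε zm zp kx ς E zm zp)
      rw [norm_zero, zero_div] at hb
      refine squeeze_zero_norm' ?_ hb
      filter_upwards [hev] with p ⟨hp1, hp2⟩
      obtain ⟨hi, hpos, -, -⟩ := main ς hς E hE p.1 p.2 hp1 hp2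
      rw [norm_div, Real.norm_of_nonneg hpos.le]
      gcongr
      exact fieldEnergy_mono hε_ge hp1 hp2 hi
    have hlim := hquot.const_sub (resonanceWidth ς)
    rw [sub_zero] at hlim
    -- Eventually the open quotient equals `Γ` minus the closed quotient, by the exact formula on
    -- each rectangle.
    refine hlim.congr' ?_
    filter_upwards [hev] with p ⟨hp1, hp2⟩
    obtain ⟨-, -, hs, heq⟩ := main ς hς E hE p.1 p.2 hp1 hp2
    have hsplit := hs.sum_add_tsum_compl (s := openChannels kx ς)
    rw [tsum_subtype] at hsplit
    have hind : (∑' m : ℤ, if m ∈ openChannels kx ς then 0 else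
        channelFlux ε zm zp kx ς E p.1 p.2 m) = ∑' m, (((openChannels kx ς : Set ℤ)ᶜ).indicator
          (channelFlux ε zm zp kx ς E p.1 p.2)) m := by
      refine tsum_congr fun m => ?_
      by_cases hm : m ∈ openChannels kx ς <;> simp [hm]
    rw [hind, heq, ← hsplit, add_div]
    ring
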